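/- A \emph{shift space} over a finite alphabet $\mathcal A$ is a closed subset $X\subseteq\mathcal A^{\mathbb Z}$ that is invariant under the shift map $\sigma(x)_i=x_{i+1}$, i.e. $\sigma(X)=X$. It is \emph{of finite type} if, for some $k\ge 0$, it is the set of all sequences in $\mathcal A^{\mathbb Z}$ containing no word from some set of words of length $k+1$. Its \emph{entropy} is $h(X)=\lim_{n\to\infty}\frac1n\log|\mathcal B_n(X)|$, where $\mathcal B_n(X)$ is the set of words of length $n$ that appear in points of $X$. A \emph{factor code} is a continuous surjective map between shift spaces (possibly over different finite alphabets) that commutes with the shift maps. \textbf{Proposition.} Let $\phi:X\to Y$ be a factor code from a shift space $X$ of finite type onto a shift space $Y$ with $h(X)>h(Y)$. Then for every $\varepsilon>0$ there exist a shift space $Z$ and factor codes $\phi_1:X\to Z$ and $\phi_2:Z\to Y$ such that $\phi=\phi_2\circ\phi_1$, $|h(Z)-h(Y)|<\varepsilon$, and $Z=\phi_1(X)$ is of finite type. -/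

import Mathlib

open SymbolicDynamics.FullShift Filter Topology

namespace ShiftSpace

section Defs

/-- The word `w` appears in the bi-infinite sequence `x` at position `i`. -/
def OccursAt {A : Type*} {n : ℕ} (w : Fin n → A) (x : ℤ → A) (i : ℤ) : Prop :=
  ∀ j : Fin n, x (i + (j : ℕ)) = w j

/-- `B_n(X)`: the set of all words of length `n` appearing in the points of `X`. -/
def words {A : Type*} [TopologicalSpace A] (X : Subshift A ℤ) (n : ℕ) : Set (Fin n → A) :=
  {w | ∃ x ∈ X.carrier, ∃ i : ℤ, OccursAt w x i}

/-- The entropy `h(X) = lim (1/n) log |B_n(X)|`. For a finite alphabet the limit exists, see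
`tendsto_entropy`. -/
noncomputable def entropy {A : Type*} [TopologicalSpace A] (X : Subshift A ℤ) : ℝ :=
  limUnder atTop (fun n : ℕ => (1 / (n : ℝ)) * Real.log ((words X n).ncard : ℝ))

/-- `X` is of finite type: for some `k ≥ 0` it is the set of all sequences that contain no word
from some set of words of length `k + 1`. -/
def IsFiniteType {A : Type*} [TopologicalSpace A] (X : Subshift A ℤ) : Prop :=
  ∃ (k : ℕ) (F : Set (Fin (k + 1) → A)),
    X.carrier = {x : ℤ → A | ∀ w ∈ F, ∀ i : ℤ, ¬ OccursAt w x i}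

/-- The shift map `σ(x)_i = x_{i+1}` on a shift space. -/
def shiftMap {A : Type*} [TopologicalSpace A] (X : Subshift A ℤ) (x : X.carrier) : X.carrier :=
  ⟨shift (1 : ℤ) x.1, X.mapsTo 1 x.2⟩

/-- A code: a continuous map between shift spaces that commutes with the shift maps. -/
structure IsCode {A B : Type*} [TopologicalSpace A] [TopologicalSpace B]
    {X : Subshift A ℤ} {Y : Subshift B ℤ} (φ : X.carrier → Y.carrier) : Prop where
  continuous : Continuous φ
  map_shift : ∀ x, φ (shiftMap X x) = shiftMap Y (φ x)

/-- A factor code: a surjective code. -/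
structure IsFactorCode {A B : Type*} [TopologicalSpace A] [TopologicalSpace B]
    {X : Subshift A ℤ} {Y : Subshift B ℤ} (φ : X.carrier → Y.carrier) : Prop where
  isCode : IsCode φ
  surjective : Function.Surjective φ

end Defs

/-- `|B_{m+n}(X)| ≤ |B_m(X)| |B_n(X)|`. -/
theorem ncard_words_add_le {A : Type*} [Finite A] [TopologicalSpace A] (X : Subshift A ℤ)
    (m n : ℕ) : (words X (m + n)).ncard ≤ (words X m).ncard * (words X n).ncard := by
  rw [← Set.ncard_prod]
  refine Set.ncard_le_ncard_of_injOn
    (fun w => (fun i => w (Fin.castAdd n i), fun i => w (Fin.natAdd m i))) ?_ ?_ (Set.toFinite _)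
  · rintro w ⟨x, hx, i, hw⟩
    refine ⟨⟨x, hx, i, fun j => by simpa using hw (Fin.castAdd n j)⟩,
      ⟨x, hx, i + m, fun j => ?_⟩⟩
    have := hw (Fin.natAdd m j)
    simpa [add_assoc] using this
  · intro w _ v _ h
    simp only [Prod.mk.injEq] at h
    funext i
    refine Fin.addCases (fun j => congrFun h.1 j) (fun j => congrFun h.2 j) i

/-- The limit that defines the entropy exists. -/
theorem tendsto_entropy {A : Type*} [Finite A] [TopologicalSpace A] (X : Subshift A ℤ) :
    Tendsto (fun n : ℕ => (1 / (n : ℝ)) * Real.log ((words X n).ncard : ℝ)) atTop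
      (𝓝 (entropy X)) := by
  have hsub : Subadditive (fun n : ℕ => Real.log ((words X n).ncard : ℝ)) := by
    intro m n
    rcases X.carrier.eq_empty_or_nonempty with h | ⟨x, hx⟩
    · simp [words, h]
    · have hpos : ∀ k, 0 < (words X k).ncard := fun k =>
        (Set.ncard_pos (Set.toFinite _)).2
          ⟨fun j => x (0 + ((j : ℕ) : ℤ)), x, hx, 0, fun _ => rfl⟩
      have h1 : ((words X m).ncard : ℝ) ≠ 0 := by exact_mod_cast (hpos m).ne'
      have h2 : ((words X n).ncard : ℝ) ≠ 0 := by exact_mod_cast (hpos n).ne'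
      rw [← Real.log_mul h1 h2]
      refine Real.log_le_log (by exact_mod_cast hpos _) ?_
      exact_mod_cast ncard_words_add_le X m n
  have hlim := hsub.tendsto_lim ⟨0, by
    rintro _ ⟨n, rfl⟩
    exact div_nonneg (Real.log_natCast_nonneg _) (Nat.cast_nonneg _)⟩
  refine tendsto_nhds_limUnder ⟨hsub.lim, ?_⟩
  refine hlim.congr fun n => ?_
  rw [div_eq_mul_inv, mul_comm, one_div]

end ShiftSpace

/-! Refine y = φ(x) by information about x that suffices for gluing but is too rare to cost entropy.
Krieger's lemma gives a shift-commuting set of markers in y, with gaps at least N, away from which y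
is locally periodic. Take T = N!·q: it is a common period of all long marker-free stretches, and q
makes reachability between windows of X along such a stretch, in T steps, idempotent. The letter of
Z at a position consists of the letter of y and a record: the window of x at a marker, only its
class for mutual reachability in T steps deep inside a marker-free stretch, nothing elsewhere.

Finite type (`exists_crossing`, `isFiniteType_of_crossing`): let x and x' have the same image in Z
on a long interval. If the interval has a marker well inside, the windows agree there and the points
are glued. Otherwise y is periodic there and the pigeonhole principle gives two positions, a
multiple of T apart, with the same class. The window of x at the first and that of x' at the second
then communicate, and idempotence yields a connecting path of exactly the right length with the same
image and the same classes (`IsIdempotentPeriod.exists_path`).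

Entropy: Y is a factor of Z, so h(Y) ≤ h(Z). Conversely, markers have density about 1/N at most, and
along steps of T in a periodic stretch a class once left is never entered again, so a block of
length K sees boundedly many changes (`ncard_changes_le`). A word of Z is thus coded by a slightly
longer word of Y and a sparse sequence of records (`ncard_words_le`, `entropy_le_add`), cheap once N
and then K are large. -/

namespace ShiftSpace

/-! ### Krieger markers and periodicity away from them -/

/-- A set of positions in a sequence, determined by a window of radius `r` in a shift-commuting way,
with gaps at least `N`. -/
structure IsMarker {B : Type*} (F : (ℤ → B) → ℤ → Prop) (N r : ℕ) : Prop where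
  congr : ∀ y y' : ℤ → B, ∀ i : ℤ, (∀ j : ℤ, i - r ≤ j → j ≤ i + r → y j = y' j) → (F y i ↔ F y' i)
  shift : ∀ (y : ℤ → B) (d i : ℤ), F (fun j => y (j + d)) i ↔ F y (i + d)
  sep : ∀ y i i', F y i → F y i' → i < i' → i + N ≤ i'

/-- The window of length `2 * N` at position `i` has a period smaller than `N`. -/
def HasShortPeriod {B : Type*} (y : ℤ → B) (N : ℕ) (i : ℤ) : Prop :=
  ∃ p : ℕ, 1 ≤ p ∧ p < N ∧ ∀ j, i ≤ j → j + p < i + 2 * N → y (j + p) = y j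

theorem HasShortPeriod.congr {B : Type*} {y y' : ℤ → B} {N : ℕ} {i : ℤ}
    (h : HasShortPeriod y N i) (hy : ∀ j, i ≤ j → j < i + 2 * N → y j = y' j) :
    HasShortPeriod y' N i := by
  obtain ⟨p, h1, h2, h3⟩ := h
  refine ⟨p, h1, h2, fun j hj hj' => ?_⟩
  rw [← hy j hj (by omega), ← hy (j + p) (by omega) hj', h3 j hj hj']

theorem hasShortPeriod_shift {B : Type*} (y : ℤ → B) (N : ℕ) (d i : ℤ) :
    HasShortPeriod (fun j => y (j + d)) N i ↔ HasShortPeriod y N (i + d) := by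
  constructor
  · rintro ⟨p, h1, h2, h3⟩
    refine ⟨p, h1, h2, fun j hj hj' => ?_⟩
    have := h3 (j - d) (by omega) (by omega)
    simpa [show j - d + p + d = j + p by ring] using this
  · rintro ⟨p, h1, h2, h3⟩
    refine ⟨p, h1, h2, fun j hj hj' => ?_⟩
    have := h3 (j + d) (by omega) (by omega)
    simpa [show j + d + p = j + p + d by ring] using this

/-- Words are treated one at a time: occurrences of the new word become markers if they have no
short period and no earlier marker lies within distance less than N. Two occurrences of one word at
distance p < N would force the period p, so new markers are separated from each other as well. -/
theorem exists_marker_of_finset {B : Type*} {N : ℕ} (hN : 1 ≤ N) (D : Finset (Fin (2 * N) → B)) :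
    ∃ (r : ℕ) (F : (ℤ → B) → ℤ → Prop), IsMarker F N r ∧
      ∀ (y : ℤ → B) (i : ℤ), (fun j : Fin (2 * N) => y (i + (j : ℕ))) ∈ D →
        (∀ j : ℤ, i - N < j → j < i + N → ¬ F y j) → HasShortPeriod y N i := by
  classical
  induction D using Finset.induction_on with
  | empty => exact ⟨0, fun _ _ => False, ⟨by simp, by simp, by simp⟩, by simp⟩
  | insert w D _ ih =>
    obtain ⟨r, F, hF, hcov⟩ := ih
    let G : (ℤ → B) → ℤ → Prop := fun y i => (∀ j : Fin (2 * N), y (i + (j : ℕ)) = w j) ∧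
      ¬ HasShortPeriod y N i ∧ ∀ j, i - N < j → j < i + N → ¬ F y j
    have hsep : ∀ y i i', G y i → G y i' → i < i' → i + N ≤ i' := by
      rintro y i i' ⟨h1, h2, -⟩ ⟨h1', -, -⟩ hlt
      by_contra hN
      refine h2 ⟨(i' - i).toNat, by omega, by omega, fun j hj hj' => ?_⟩
      have e1 := h1 ⟨(j - i).toNat, by omega⟩
      have e2 := h1' ⟨(j - i).toNat, by omega⟩
      rw [← e1] at e2
      convert e2 using 2 <;> simp only [] <;> omega
    have hcongr : ∀ y y' : ℤ → B, ∀ i : ℤ,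
        (∀ j : ℤ, i - (r + 2 * N : ℕ) ≤ j → j ≤ i + (r + 2 * N : ℕ) → y j = y' j) →
        G y i → G y' i := by
      rintro y y' i h ⟨h1, h2, h3⟩
      refine ⟨fun j => ?_, fun h' => h2 (h'.congr fun j _ _ => (h j ?_ ?_).symm),
        fun j hj hj' => ?_⟩
      · rw [← h1 j, h] <;> omega
      · omega
      · omega
      · rw [← hF.congr y y' j fun l _ _ => h l (by omega) (by omega)]
        exact h3 j hj hj'
    refine ⟨r + 2 * N, fun y i => F y i ∨ G y i, ⟨fun y y' i h => ?_, fun y d i => ?_, ?_⟩, ?_⟩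
    · rw [hF.congr y y' i fun l _ _ => h l (by omega) (by omega)]
      exact or_congr Iff.rfl ⟨hcongr y y' i h, hcongr y' y i fun j a b => (h j a b).symm⟩
    · refine or_congr (hF.shift y d i) ?_
      refine and_congr ?_ (and_congr (not_congr (hasShortPeriod_shift y N d i)) ?_)
      · simp only [add_right_comm]
      · simp only [hF.shift]
        constructor
        · intro h j hj hj'
          simpa using h (j - d) (by omega) (by omega)
        · intro h j hj hj'
          exact h (j + d) (by omega) (by omega)
    · rintro y i i' (h | h) (h' | h') hlt
      · exact hF.sep y i i' h h' hlt
      · by_contra hN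
        exact h'.2.2 i (by omega) (by omega) h
      · by_contra hN
        exact h.2.2 i' (by omega) (by omega) h'
      · exact hsep y i i' h h' hlt
    · intro y i hi hno
      rcases Finset.mem_insert.1 hi with h | h
      · by_contra hp
        exact hno i (by omega) (by omega) (Or.inr ⟨fun j => congrFun h j, hp,
          fun j a b hj => hno j a b (Or.inl hj)⟩)
      · exact hcov y i h fun j a b hj => hno j a b (Or.inl hj)

/-- Krieger's marker lemma for a full shift. -/
theorem exists_marker (B : Type*) [Finite B] {N : ℕ} (hN : 1 ≤ N) :
    ∃ (r : ℕ) (F : (ℤ → B) → ℤ → Prop), IsMarker F N r ∧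
      ∀ (y : ℤ → B) (i : ℤ), (∀ j : ℤ, i - N < j → j < i + N → ¬ F y j) → HasShortPeriod y N i := by
  have := Fintype.ofFinite (Fin (2 * N) → B)
  obtain ⟨r, F, h, h'⟩ := exists_marker_of_finset hN (Finset.univ : Finset (Fin (2 * N) → B))
  exact ⟨r, F, h, fun y i => h' y i (Finset.mem_univ _)⟩

/-- The period of the first window propagates to the right one letter at a time. Windows of length
2N are long enough because two periods smaller than N fit into one. -/
theorem exists_period_of_forall_hasShortPeriod {B : Type*} {y : ℤ → B} {N : ℕ} {s : ℤ} (n : ℕ)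
    (h : ∀ i, s ≤ i → i ≤ s + n → HasShortPeriod y N i) :
    ∃ p : ℕ, 1 ≤ p ∧ p < N ∧ ∀ j, s ≤ j → j + p < s + n + 2 * N → y (j + p) = y j := by
  obtain ⟨p, h1, h2, h3⟩ := h s le_rfl (by omega)
  refine ⟨p, h1, h2, ?_⟩
  induction n with
  | zero => simpa using h3
  | succ n ih =>
    have ih := ih fun i hi hi' => h i hi (by push_cast; omega)
    obtain ⟨p', h1', h2', h3'⟩ := h (s + n + 1) (by omega) (by push_cast; omega)
    intro j hj hj'
    rcases lt_or_eq_of_le (show j + p ≤ s + n + 2 * N by push_cast at hj'; omega) with hlt | heq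
    · exact ih j hj hlt
    -- The new letter, at j + p, is compared with the one at j by going back p', back p and forward
    -- p'; p + p' < 2N keeps all this inside the last window.
    · have e1 := h3' (j + p - p') (by omega) (by omega)
      have e2 := ih (j - p') (by omega) (by omega)
      have e3 := h3' (j - p') (by omega) (by omega)
      rw [show j + p - p' + p' = j + p by ring] at e1
      rw [show j - p' + p = j + p - p' by ring] at e2
      rw [sub_add_cancel] at e3
      rw [e1, e2, e3]

theorem exists_periodic_extension {B : Type*} {y : ℤ → B} {p : ℕ} (hp : 1 ≤ p) {s e : ℤ}
    (h : ∀ j, s ≤ j → j + p < e → y (j + p) = y j) :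
    ∃ u : ℤ → B, (∀ j, u (j + p) = u j) ∧ ∀ j, s ≤ j → j < e → u j = y j := by
  refine ⟨fun j => y (s + (j - s) % p), fun j => ?_, ?_⟩
  · simp [show j + p - s = j - s + p by ring]
  · have key : ∀ n : ℕ, s + n < e → y (s + (n : ℤ) % p) = y (s + n) := by
      intro n
      induction n using Nat.strong_induction_on with
      | _ n ih =>
        intro hn
        rcases lt_or_ge n p with hlt | hge
        · rw [Int.emod_eq_of_lt (by omega) (by omega)]
        · obtain ⟨m, rfl⟩ := Nat.exists_eq_add_of_le' hge
          have := ih m (by omega) (by push_cast at hn; omega)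
          push_cast at hn ⊢
          rw [Int.add_emod_right, this, ← add_assoc, h _ (by omega) (by omega)]
    intro j hj hje
    have := key (j - s).toNat (by omega)
    simpa [Int.toNat_of_nonneg (sub_nonneg.2 hj)] using this

/-- The actual period p < N depends on the run; N! is a multiple of all of them. Windows start at
distance N from the ends of the run and have length 2N, hence the range from s + N to e + N. -/
theorem exists_periodic_of_no_marker {B : Type*} {F : (ℤ → B) → ℤ → Prop} {N : ℕ}
    (hF : ∀ (y : ℤ → B) (i : ℤ), (∀ j : ℤ, i - N < j → j < i + N → ¬ F y j) → HasShortPeriod y N i)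
    {y : ℤ → B} {s e : ℤ} (hse : s + 2 * N ≤ e) (h : ∀ j, s ≤ j → j ≤ e → ¬ F y j) :
    ∃ u : ℤ → B, (∀ j, u (j + N.factorial) = u j) ∧
      ∀ j, s + N ≤ j → j < e + N → u j = y j := by
  obtain ⟨p, h1, h2, h3⟩ := exists_period_of_forall_hasShortPeriod (y := y) (N := N) (s := s + N)
    (e - s - 2 * N).toNat fun i hi hi' => hF y i fun j hj hj' => h j (by omega) (by omega)
  obtain ⟨u, hu, hu'⟩ := exists_periodic_extension (e := e + N) h1
    fun j hj hj' => h3 j hj (by omega)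
  refine ⟨u, fun j => ?_, hu'⟩
  obtain ⟨c, hc⟩ := Nat.dvd_factorial h1 h2.le
  have : Function.Periodic u (p : ℤ) := hu
  rw [hc, mul_comm]
  simpa using this.nat_mul c j

/-- A uniform exponent that makes all self-maps of a finite type idempotent. -/
theorem exists_idempotent_exponent (α : Type*) [Finite α] :
    ∃ q : ℕ, 1 ≤ q ∧ ∀ (g : α → α) (n : ℕ), g^[q * (n + 1)] = g^[q] := by
  have := Fintype.ofFinite (α → α)
  set c := Fintype.card (α → α) with hc
  refine ⟨c.factorial, c.factorial_pos, fun g n => ?_⟩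
  -- Two of the powers 0, ..., c of g coincide, so its powers are eventually periodic with preperiod
  -- and period at most c; c! is at least the former and a multiple of the latter.
  obtain ⟨i, j, hij, he⟩ := Fintype.exists_ne_map_eq_of_card_lt
    (fun i : Fin (c + 1) => g^[i]) (by simp [← hc])
  wlog hlt : i < j generalizing i j
  · exact this j i hij.symm he.symm (lt_of_le_of_ne (not_lt.1 hlt) hij.symm)
  obtain ⟨d, hd⟩ := Nat.exists_eq_add_of_lt (show (i : ℕ) < j from hlt)
  have step : ∀ m, g^[i + m + (d + 1)] = g^[i + m] := fun m => by
    rw [show (i : ℕ) + m + (d + 1) = m + j by omega, Function.iterate_add, ← he,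
      ← Function.iterate_add, add_comm]
  have steps : ∀ t m, g^[i + m + (d + 1) * t] = g^[i + m] := fun t => by
    induction t with
    | zero => simp
    | succ t ih =>
      intro m
      rw [show (i : ℕ) + m + (d + 1) * (t + 1) = i + (m + (d + 1) * t) + (d + 1) by ring, step,
        ← add_assoc, ih]
  obtain ⟨a, ha⟩ : d + 1 ∣ c.factorial := Nat.dvd_factorial (by omega) (by omega)
  obtain ⟨b, hb⟩ := Nat.exists_eq_add_of_le
    (show (i : ℕ) ≤ c.factorial from le_trans (by omega) (Nat.self_le_factorial c))
  have := steps (a * n) b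
  rw [← hb, ← mul_assoc, ← ha] at this
  rw [mul_add, mul_one, add_comm, this]

end ShiftSpace

namespace ShiftSpace

/-! ### Local factors, paths between windows, and records -/

/-- The window of radius `k` of `x` around position `i`. -/
def state {A : Type*} (k : ℕ) (x : ℤ → A) (i : ℤ) : Fin (2 * k + 1) → A :=
  fun j => x (i - k + (j : ℕ))

theorem state_eq_iff {A : Type*} {k : ℕ} {x x' : ℤ → A} {i : ℤ} :
    state k x i = state k x' i ↔ ∀ j, i - k ≤ j → j ≤ i + k → x j = x' j := by
  constructor
  · intro h j hj hj'
    have := congrFun h ⟨(j - (i - k)).toNat, by omega⟩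
    simp only [state, Int.toNat_of_nonneg (sub_nonneg.2 hj)] at this
    simpa using this
  · intro h
    funext j
    exact h _ (by omega) (by omega)

theorem state_shift {A : Type*} (k : ℕ) (x : ℤ → A) (d i : ℤ) :
    state k (fun j => x (j + d)) i = state k x (i + d) := by
  funext j
  simp only [state]
  congr 1
  ring

/-- A shift-invariant set `X` of sequences in which points agreeing on a window of radius `k` can be
glued, together with a shift-commuting map `f` on `X` given by a local rule of radius `k`. -/
structure LocalFactor (A B : Type*) where
  X : Set (ℤ → A)
  f : (ℤ → A) → ℤ → B
  k : ℕ
  shift_mem : ∀ x ∈ X, ∀ d : ℤ, (fun j => x (j + d)) ∈ X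
  f_shift : ∀ x ∈ X, ∀ d i : ℤ, f (fun j => x (j + d)) i = f x (i + d)
  f_congr : ∀ x ∈ X, ∀ x' ∈ X, ∀ i, state k x i = state k x' i → f x i = f x' i
  glue_mem : ∀ x ∈ X, ∀ x' ∈ X, ∀ a, state k x a = state k x' a →
    (fun j => if j < a then x j else x' j) ∈ X

namespace LocalFactor

variable {A B : Type*} (c : LocalFactor A B)

/-- The windows of the domain. -/
abbrev State := Fin (2 * c.k + 1) → A

/-- The window of `x` at position `i`. -/
abbrev st (x : ℤ → A) (i : ℤ) : c.State := state c.k x i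

theorem exists_glue {x x' : ℤ → A} (hx : x ∈ c.X) (hx' : x' ∈ c.X) {a : ℤ}
    (h : c.st x a = c.st x' a) :
    ∃ z ∈ c.X, (∀ i ≤ a, c.st z i = c.st x i) ∧ ∀ i, a ≤ i → c.st z i = c.st x' i := by
  have h' := state_eq_iff.1 h
  refine ⟨_, c.glue_mem x hx x' hx' a h, fun i hi => ?_, fun i hi => ?_⟩
  · refine state_eq_iff.2 fun j hj hj' => ?_
    split_ifs with hja
    · rfl
    · exact (h' j (by omega) (by omega)).symm
  · refine state_eq_iff.2 fun j hj hj' => ?_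
    split_ifs with hja
    · exact h' j (by omega) (by omega)
    · rfl

/-- Some point of the domain has windows `a` at `i` and `b` at `i + n` and image `u` in between. -/
def Path (u : ℤ → B) (i : ℤ) (n : ℕ) (a b : c.State) : Prop :=
  ∃ x ∈ c.X, c.st x i = a ∧ c.st x (i + n) = b ∧ ∀ j, i ≤ j → j < i + n → c.f x j = u j

variable {c}

theorem path_of_mem {x : ℤ → A} (hx : x ∈ c.X) {u : ℤ → B} {i : ℤ} {n : ℕ}
    (h : ∀ j, i ≤ j → j < i + n → c.f x j = u j) : c.Path u i n (c.st x i) (c.st x (i + n)) :=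
  ⟨x, hx, rfl, rfl, h⟩

theorem Path.congr {u u' : ℤ → B} {i : ℤ} {n : ℕ} {a b : c.State} (h : c.Path u i n a b)
    (hu : ∀ j, i ≤ j → j < i + n → u j = u' j) : c.Path u' i n a b := by
  obtain ⟨x, hx, h1, h2, h3⟩ := h
  exact ⟨x, hx, h1, h2, fun j hj hj' => (h3 j hj hj').trans (hu j hj hj')⟩

theorem path_congr {u u' : ℤ → B} {i : ℤ} {n : ℕ} {a b : c.State}
    (hu : ∀ j, i ≤ j → j < i + n → u j = u' j) : c.Path u i n a b ↔ c.Path u' i n a b :=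
  ⟨fun h => h.congr hu, fun h => h.congr fun j hj hj' => (hu j hj hj').symm⟩

theorem Path.trans {u : ℤ → B} {i : ℤ} {n m : ℕ} {a b d : c.State} (h : c.Path u i n a b)
    (h' : c.Path u (i + n) m b d) : c.Path u i (n + m) a d := by
  obtain ⟨x, hx, h1, h2, h3⟩ := h
  obtain ⟨x', hx', h1', h2', h3'⟩ := h'
  obtain ⟨z, hz, hl, hr⟩ := c.exists_glue hx hx' (h2.trans h1'.symm)
  refine ⟨z, hz, (hl i (by omega)).trans h1, ?_, fun j hj hj' => ?_⟩
  · rw [hr _ (by omega), ← h2']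
    push_cast
    rw [add_assoc]
  · rcases lt_or_ge j (i + n) with hlt | hge
    · rw [c.f_congr z hz x hx j (hl j hlt.le), h3 j hj hlt]
    · rw [c.f_congr z hz x' hx' j (hr j hge), h3' j hge (by push_cast at hj'; omega)]

theorem Path.split {u : ℤ → B} {i : ℤ} {n m : ℕ} {a d : c.State} (h : c.Path u i (n + m) a d) :
    ∃ b, c.Path u i n a b ∧ c.Path u (i + n) m b d := by
  obtain ⟨x, hx, h1, h2, h3⟩ := h
  refine ⟨c.st x (i + n), ⟨x, hx, h1, rfl, fun j hj hj' => h3 j hj (by push_cast; omega)⟩,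
    x, hx, rfl, ?_, fun j hj hj' => h3 j (by omega) (by push_cast; omega)⟩
  rw [← h2]
  push_cast
  rw [add_assoc]

theorem Path.shift {u : ℤ → B} {i : ℤ} {n : ℕ} {a b : c.State} (d : ℤ)
    (h : c.Path u (i + d) n a b) : c.Path (fun j => u (j + d)) i n a b := by
  obtain ⟨x, hx, h1, h2, h3⟩ := h
  refine ⟨_, c.shift_mem x hx d, (state_shift _ _ _ _).trans h1, ?_, fun j hj hj' => ?_⟩
  · rw [← h2, st, state_shift, add_right_comm]
  · rw [c.f_shift x hx]
    exact h3 _ (by omega) (by omega)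

theorem path_shift {u : ℤ → B} {i : ℤ} {n : ℕ} {a b : c.State} (d : ℤ) :
    c.Path (fun j => u (j + d)) i n a b ↔ c.Path u (i + d) n a b := by
  refine ⟨fun h => ?_, Path.shift d⟩
  have := Path.shift (i := i + d) (-d) (by simpa using h)
  simpa using this

theorem path_add_period {u : ℤ → B} {d : ℤ} (hu : ∀ j, u (j + d) = u j) {i : ℤ} {n : ℕ}
    {a b : c.State} : c.Path u (i + d) n a b ↔ c.Path u i n a b := by
  rw [← path_shift d]
  simp only [hu]

/-- For a sequence with period `m`, the relation `Path u i (m * q)` is idempotent if `q` is an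
idempotent exponent for the self-maps of `Set c.State`. -/
theorem path_mul_succ {m q : ℕ}
    (hq : ∀ (g : Set c.State → Set c.State) (n : ℕ), g^[q * (n + 1)] = g^[q])
    {u : ℤ → B} (hu : ∀ j, u (j + m) = u j) {i : ℤ} (n : ℕ) {a b : c.State} :
    c.Path u i (m * q * (n + 1)) a b ↔ c.Path u i (m * q) a b := by
  -- `g` pushes sets of windows forward along one period of `u`. The correspondence with iterates
  -- needs a positive exponent: a path of length 0 from `a` to itself exists only if `a` occurs in a
  -- point.
  let g : Set c.State → Set c.State := fun U => {b | ∃ a ∈ U, c.Path u i m a b}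
  have hit : ∀ (t : ℕ) (a b : c.State), c.Path u i (m * (t + 1)) a b ↔ b ∈ g^[t + 1] {a} := by
    intro t
    induction t with
    | zero => intro a b; simp [g]
    | succ t ih =>
      intro a b
      rw [Function.iterate_succ_apply', mul_add, mul_one]
      have hper : ∀ j, u (j + (m * (t + 1) : ℕ)) = u j := by
        have : Function.Periodic u (m : ℤ) := hu
        intro j
        have := this.nat_mul (t + 1) j
        push_cast at this ⊢
        rwa [mul_comm (m : ℤ)]
      constructor
      · intro h
        obtain ⟨d, h1, h2⟩ := h.split
        exact ⟨d, (ih a d).1 h1, (path_add_period hper).1 h2⟩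
      · rintro ⟨d, h1, h2⟩
        exact ((ih a d).2 h1).trans ((path_add_period hper).2 h2)
  rcases Nat.eq_zero_or_pos q with rfl | hpos
  · simp
  · obtain ⟨t, rfl⟩ := Nat.exists_eq_add_of_le' hpos
    obtain ⟨l, hl⟩ : ∃ l, (t + 1) * (n + 1) = l + 1 := ⟨t * n + t + n, by ring⟩
    rw [hit t, mul_assoc, hl, hit l, ← hl, hq]

variable (c)

/-- The class of `s` for mutual reachability in `T` steps from position `i`. -/
def cls (T : ℕ) (u : ℤ → B) (i : ℤ) (s : c.State) : Set c.State :=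
  -- A window need not reach itself in T steps, so reflexivity is imposed.
  {b | b = s ∨ (c.Path u i T s b ∧ c.Path u i T b s)}

end LocalFactor

/-- There is no marker within distance `K` of position `i`. -/
def Deep {B : Type*} (F : (ℤ → B) → ℤ → Prop) (K : ℕ) (y : ℤ → B) (i : ℤ) : Prop :=
  ∀ j : ℤ, i - K ≤ j → j ≤ i + K → ¬ F y j

theorem Deep.not_marker {B : Type*} {F : (ℤ → B) → ℤ → Prop} {K : ℕ} {y : ℤ → B} {i : ℤ}
    (h : Deep F K y i) : ¬ F y i := h i (by omega) (by omega)

theorem IsMarker.deep_congr {B : Type*} {F : (ℤ → B) → ℤ → Prop} {N r K : ℕ} (hF : IsMarker F N r)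
    {y y' : ℤ → B} {i : ℤ} (h : ∀ j, i - (r + K : ℕ) ≤ j → j ≤ i + (r + K : ℕ) → y j = y' j) :
    Deep F K y i ↔ Deep F K y' i := by
  refine forall_congr' fun j => forall_congr' fun h1 => forall_congr' fun h2 => not_congr ?_
  exact hF.congr y y' j fun l _ _ => h l (by omega) (by omega)

theorem IsMarker.deep_shift {B : Type*} {F : (ℤ → B) → ℤ → Prop} {N r : ℕ} (hF : IsMarker F N r)
    (K : ℕ) (y : ℤ → B) (d i : ℤ) : Deep F K (fun j => y (j + d)) i ↔ Deep F K y (i + d) := by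
  simp only [Deep, hF.shift]
  constructor
  · intro h j hj hj'
    simpa using h (j - d) (by omega) (by omega)
  · intro h j hj hj'
    exact h (j + d) (by omega) (by omega)

namespace LocalFactor

variable {A B : Type*} (c : LocalFactor A B)

open Classical in
/-- The information about `x` kept at position `i` besides the image of `x`: the window at a marked
position, its class at a position far from all markers, nothing elsewhere. -/
noncomputable def record (F : (ℤ → B) → ℤ → Prop) (T K : ℕ) (x : ℤ → A) (i : ℤ) : Set c.State :=
  if F (c.f x) i then {c.st x i}
  else if Deep F K (c.f x) i then c.cls T (c.f x) i (c.st x i) else ∅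

variable {c} {F : (ℤ → B) → ℤ → Prop} {N r : ℕ} {T K : ℕ}

theorem record_of_marker {x : ℤ → A} {i : ℤ} (h : F (c.f x) i) :
    c.record F T K x i = {c.st x i} := if_pos h

theorem record_of_deep {x : ℤ → A} {i : ℤ} (h : Deep F K (c.f x) i) :
    c.record F T K x i = c.cls T (c.f x) i (c.st x i) := by
  rw [record, if_neg h.not_marker, if_pos h]

theorem record_of_not {x : ℤ → A} {i : ℤ} (h : ¬ F (c.f x) i) (h' : ¬ Deep F K (c.f x) i) :
    c.record F T K x i = ∅ := by
  rw [record, if_neg h, if_neg h']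

theorem cls_congr {u u' : ℤ → B} {i : ℤ} (h : ∀ j, i ≤ j → j < i + T → u j = u' j) (s : c.State) :
    c.cls T u i s = c.cls T u' i s := by
  simp only [cls, path_congr h]

theorem record_congr (hF : IsMarker F N r) {x x' : ℤ → A} {i : ℤ}
    (h : ∀ j, i - (r + K + T : ℕ) ≤ j → j ≤ i + (r + K + T : ℕ) → c.f x j = c.f x' j)
    (hs : c.st x i = c.st x' i) : c.record F T K x i = c.record F T K x' i := by
  unfold record
  rw [hF.congr _ _ i fun j _ _ => h j (by omega) (by omega),
    hF.deep_congr fun j _ _ => h j (by omega) (by omega),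
    cls_congr (fun j _ _ => h j (by omega) (by omega)), hs]

theorem record_shift (hF : IsMarker F N r) {x : ℤ → A} (hx : x ∈ c.X) (d i : ℤ) :
    c.record F T K (fun j => x (j + d)) i = c.record F T K x (i + d) := by
  have hf : c.f (fun j => x (j + d)) = fun i => c.f x (i + d) := funext fun i => c.f_shift x hx d i
  unfold record
  rw [hf, hF.shift, hF.deep_shift, st, state_shift]
  simp only [cls, path_shift]

end LocalFactor

end ShiftSpace

namespace ShiftSpace
namespace LocalFactor

variable {A B : Type*} {c : LocalFactor A B} {F : (ℤ → B) → ℤ → Prop} {N r : ℕ} {T K : ℕ}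

/-! ### Communicating classes along an idempotent period -/

/-- `u` has period `T` and reachability along `u` in `T` steps is idempotent. -/
structure IsIdempotentPeriod (c : LocalFactor A B) (T : ℕ) (u : ℤ → B) : Prop where
  periodic : ∀ j, u (j + T) = u j
  path_mul : ∀ (i : ℤ) (n : ℕ) (a b : c.State), c.Path u i (T * (n + 1)) a b ↔ c.Path u i T a b

theorem isIdempotentPeriod_mul {m q : ℕ}
    (hq : ∀ (g : Set c.State → Set c.State) (n : ℕ), g^[q * (n + 1)] = g^[q])
    {u : ℤ → B} (hu : ∀ j, u (j + m) = u j) : c.IsIdempotentPeriod (m * q) u := by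
  refine ⟨fun j => ?_, fun i n a b => path_mul_succ hq hu n⟩
  have h : Function.Periodic u (m : ℤ) := hu
  have := h.nat_mul q j
  push_cast
  rwa [mul_comm (m : ℤ)]

namespace IsIdempotentPeriod

variable {u : ℤ → B} (hu : c.IsIdempotentPeriod T u)
include hu

theorem periodic_mul (n : ℕ) (j : ℤ) : u (j + (T * n : ℕ)) = u j := by
  have h : Function.Periodic u (T : ℤ) := hu.periodic
  have := h.nat_mul n j
  push_cast
  rwa [mul_comm (T : ℤ)]

theorem path_add (n : ℕ) {i : ℤ} {l : ℕ} {a b : c.State} :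
    c.Path u (i + (T * n : ℕ)) l a b ↔ c.Path u i l a b :=
  path_add_period (hu.periodic_mul n)

/-- Idempotence compresses two turns around the period into one, so reachability in exactly T steps
is transitive. -/
theorem trans {i : ℤ} {a b d : c.State} (h : c.Path u i T a b) (h' : c.Path u i T b d) :
    c.Path u i T a d := by
  rw [← hu.path_mul i 1, mul_add, mul_one]
  exact h.trans ((path_add_period hu.periodic).2 h')

theorem cls_add (n : ℕ) (i : ℤ) (s : c.State) :
    c.cls T u (i + (T * n : ℕ)) s = c.cls T u i s := by
  simp only [cls, hu.path_add]

theorem cls_eq {i : ℤ} {s b : c.State} (h : c.Path u i T s b) (h' : c.Path u i T b s) :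
    c.cls T u i b = c.cls T u i s := by
  have key : ∀ {s b : c.State}, c.Path u i T s b → c.Path u i T b s →
      c.cls T u i b ⊆ c.cls T u i s := by
    rintro s b h h' d (rfl | ⟨h1, h2⟩)
    · exact Or.inr ⟨h, h'⟩
    · exact Or.inr ⟨hu.trans h h1, hu.trans h2 h'⟩
  exact Set.Subset.antisymm (key h h') (key h' h)

end IsIdempotentPeriod

theorem self_mem_cls (u : ℤ → B) (i : ℤ) (s : c.State) : s ∈ c.cls T u i s := Or.inl rfl

/-- Along a run without markers the classes at distance `T` are monotone, so they cannot return. -/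
theorem IsIdempotentPeriod.cls_eq_of_cls_eq {u : ℤ → B} (hu : c.IsIdempotentPeriod T u)
    {x : ℤ → A} (hx : x ∈ c.X) {i : ℤ} {n : ℕ}
    (hxu : ∀ j, i ≤ j → j < i + (T * (n + 1) : ℕ) → c.f x j = u j)
    (h : c.cls T u i (c.st x i) = c.cls T u i (c.st x (i + (T * (n + 1) : ℕ)))) :
    c.cls T u i (c.st x (i + (T * n : ℕ))) = c.cls T u i (c.st x (i + (T * (n + 1) : ℕ))) := by
  rcases n with _ | n
  · simpa using h
  set s := c.st x i
  set m := c.st x (i + (T * (n + 1) : ℕ)) with hm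
  set t := c.st x (i + (T * (n + 1 + 1) : ℕ)) with ht
  have h1 : c.Path u i T s m := (hu.path_mul i n _ _).1
    (path_of_mem hx fun j hj hj' => hxu j hj (hj'.trans_le (by push_cast; nlinarith)))
  have h2 : c.Path u i T m t := by
    have : c.Path u (i + (T * (n + 1) : ℕ)) T m t := by
      have := path_of_mem hx (i := i + (T * (n + 1) : ℕ)) (n := T) (u := u)
        fun j hj hj' => hxu j (by omega) (hj'.trans_le (by push_cast; linarith))
      convert this using 2
      push_cast
      ring
    exact (hu.path_add (n + 1)).1 this
  -- The last window t lies in the class of s, so t = s or t reaches s. Since s reaches m and m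
  -- reaches t, the windows m and t communicate.
  have h3 : t ∈ c.cls T u i s := h ▸ self_mem_cls u i t
  rcases h3 with h3 | ⟨-, h3⟩
  · rw [h3] at h2 ⊢
    exact hu.cls_eq h1 h2
  · exact hu.cls_eq (hu.trans h3 h1) h2

/-- The window s of x at j communicates with t', and idempotence stretches a path of length T from s
to t' to length T(n+1). Intermediate windows of x and z communicate: continue to the right end,
return to s in T steps, and follow the other point; the total length T(n+2) compresses to T. -/
theorem IsIdempotentPeriod.exists_path {u : ℤ → B} (hu : c.IsIdempotentPeriod T u)
    {x x' : ℤ → A} (hx : x ∈ c.X) {j : ℤ} {n : ℕ}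
    (hxu : ∀ i, j ≤ i → i < j + (T * (n + 1) : ℕ) → c.f x i = u i)
    (h : c.cls T u j (c.st x j) = c.cls T u j (c.st x (j + (T * (n + 1) : ℕ))))
    (h' : c.cls T u j (c.st x j) = c.cls T u j (c.st x' (j + (T * (n + 1) : ℕ)))) :
    ∃ z ∈ c.X, c.st z j = c.st x j ∧
      c.st z (j + (T * (n + 1) : ℕ)) = c.st x' (j + (T * (n + 1) : ℕ)) ∧
      (∀ i, j ≤ i → i < j + (T * (n + 1) : ℕ) → c.f z i = u i) ∧
      ∀ i, j ≤ i → i < j + (T * (n + 1) : ℕ) →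
        c.cls T u i (c.st z i) = c.cls T u i (c.st x i) := by
  set s := c.st x j with hs
  set t := c.st x (j + (T * (n + 1) : ℕ)) with ht
  set t' := c.st x' (j + (T * (n + 1) : ℕ)) with ht'
  have est : c.Path u j T s t := (hu.path_mul j n _ _).1 (path_of_mem hx hxu)
  have ets : c.Path u j T t s := by
    have : t ∈ c.cls T u j s := h ▸ self_mem_cls u j t
    rcases this with h3 | ⟨-, h3⟩
    · rwa [h3] at est ⊢
    · exact h3
  have ess := hu.trans est ets
  obtain ⟨est', ets'⟩ : c.Path u j T s t' ∧ c.Path u j T t' s := by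
    have : t' ∈ c.cls T u j s := h' ▸ self_mem_cls u j t'
    rcases this with h3 | h3
    · rw [h3]; exact ⟨ess, ess⟩
    · exact h3
  obtain ⟨z, hz, hz1, hz2, hz3⟩ := (hu.path_mul j n _ _).2 est'
  refine ⟨z, hz, hz1, hz2, hz3, fun i hi hi' => ?_⟩
  obtain ⟨m, rfl⟩ := Int.le.dest hi
  obtain ⟨l, hl⟩ : ∃ l, T * (n + 1) = m + l := Nat.exists_eq_add_of_le (by omega)
  have e : j + (m : ℤ) + l = j + (T * (n + 1) : ℕ) := by rw [hl]; push_cast; ring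
  have key : ∀ {w w' : ℤ → A} (_ : w ∈ c.X) (_ : w' ∈ c.X)
      (_ : ∀ i, j ≤ i → i < j + (T * (n + 1) : ℕ) → c.f w i = u i)
      (_ : ∀ i, j ≤ i → i < j + (T * (n + 1) : ℕ) → c.f w' i = u i)
      (_ : c.Path u j T (c.st w (j + (T * (n + 1) : ℕ))) (c.st w' j)),
      c.Path u (j + m) T (c.st w (j + m)) (c.st w' (j + m)) := by
    intro w w' hw hw' hwu hwu' hp
    have p1 : c.Path u (j + m) l (c.st w (j + m)) (c.st w (j + (T * (n + 1) : ℕ))) := by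
      rw [← e]
      exact path_of_mem hw fun i hi hi' => hwu i (by omega) (by omega)
    have p2 : c.Path u (j + m + l) T (c.st w (j + (T * (n + 1) : ℕ))) (c.st w' j) := by
      rw [e]
      exact (hu.path_add _).2 hp
    have p3 : c.Path u (j + m + (l + T : ℕ)) m (c.st w' j) (c.st w' (j + m)) := by
      have : j + (m : ℤ) + (l + T : ℕ) = j + (T * (n + 1 + 1) : ℕ) := by
        rw [mul_add _ (n + 1), hl]; push_cast; ring
      rw [this]
      exact (hu.path_add _).2 (path_of_mem hw' fun i hi hi' => hwu' i (by omega) (by omega))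
    rw [← hu.path_mul _ (n + 1)]
    have := (p1.trans p2).trans p3
    rwa [show l + T + m = T * (n + 1 + 1) by rw [mul_add _ (n + 1), hl]; ring] at this
  refine hu.cls_eq (key hx hz hxu hz3 ?_) (key hz hx hz3 hxu ?_)
  · rw [hz1]; exact ets
  · rw [hz2]; exact ets'

end LocalFactor
end ShiftSpace

namespace ShiftSpace
namespace LocalFactor

variable {A B : Type*} {c : LocalFactor A B} {F : (ℤ → B) → ℤ → Prop} {N r : ℕ} {T K : ℕ}

/-! ### Crossing points with equal records -/

/-- Along runs without markers, sequences look like sequences with an idempotent period `T`. -/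
def RunsPeriodic (c : LocalFactor A B) (F : (ℤ → B) → ℤ → Prop) (N T : ℕ) : Prop :=
  ∀ (y : ℤ → B) (s e : ℤ), s + 2 * N ≤ e → (∀ j, s ≤ j → j ≤ e → ¬ F y j) →
    ∃ u, c.IsIdempotentPeriod T u ∧ ∀ j, s + N ≤ j → j < e + N → u j = y j

theorem runsPeriodic {q : ℕ}
    (hF : ∀ (y : ℤ → B) (i : ℤ), (∀ j : ℤ, i - N < j → j < i + N → ¬ F y j) →
      HasShortPeriod y N i)
    (hq : ∀ (g : Set c.State → Set c.State) (n : ℕ), g^[q * (n + 1)] = g^[q]) :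
    c.RunsPeriodic F N (N.factorial * q) := by
  intro y s e hse h
  obtain ⟨u, hu, hu'⟩ := exists_periodic_of_no_marker hF hse h
  exact ⟨u, isIdempotentPeriod_mul hq hu, hu'⟩

/-- `z` has the same image and the same record as `x` at position `i`. -/
def Same (c : LocalFactor A B) (F : (ℤ → B) → ℤ → Prop) (T K : ℕ) (z x : ℤ → A) (i : ℤ) : Prop :=
  c.f z i = c.f x i ∧ c.record F T K z i = c.record F T K x i

/-- A record depends on one window and on the image within distance r + K + T, so margins of this
size let the record of z be read off from x on the left and from x' on the right. Images are
compared before records, so `hc` may use their agreement. -/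
theorem same_of_glue (hF : IsMarker F N r) {x x' z : ℤ → A} (hx : x ∈ c.X) (hx' : x' ∈ c.X)
    (hz : z ∈ c.X) {a b j j' : ℤ} (haj : a + (r + K + T : ℕ) ≤ j) (hjj : j ≤ j')
    (hjb : j' + (r + K + T : ℕ) ≤ b)
    (h : ∀ i, a ≤ i → i ≤ b → Same c F T K x x' i)
    (hl : ∀ i ≤ j, c.st z i = c.st x i) (hr : ∀ i, j' ≤ i → c.st z i = c.st x' i)
    (hm : ∀ i, j ≤ i → i < j' → c.f z i = c.f x i)
    (hc : (∀ i ≤ b, c.f z i = c.f x i) → ∀ i, j < i → i < j' →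
      c.record F T K z i = c.record F T K x i) :
    (∀ i ≤ b, Same c F T K z x i) ∧ ∀ i, a ≤ i → Same c F T K z x' i := by
  have fl : ∀ i ≤ b, c.f z i = c.f x i := by
    intro i hi
    rcases le_or_gt i j with h1 | h1
    · exact c.f_congr z hz x hx i (hl i h1)
    rcases lt_or_ge i j' with h2 | h2
    · exact hm i h1.le h2
    · rw [c.f_congr z hz x' hx' i (hr i h2), (h i (by omega) hi).1]
  have fr : ∀ i, a ≤ i → c.f z i = c.f x' i := by
    intro i hi
    rcases le_or_gt i b with h1 | h1
    · rw [fl i h1, (h i hi h1).1]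
    · exact c.f_congr z hz x' hx' i (hr i (by omega))
  have rl : ∀ i < j', c.record F T K z i = c.record F T K x i := by
    intro i hi
    rcases le_or_gt i j with h1 | h1
    · exact record_congr hF (fun l _ _ => fl l (by omega)) (hl i h1)
    · exact hc fl i h1 hi
  have rr : ∀ i, j' ≤ i → c.record F T K z i = c.record F T K x' i := by
    intro i hi
    exact record_congr hF (fun l _ _ => fr l (by omega)) (hr i hi)
  refine ⟨fun i hi => ⟨fl i hi, ?_⟩, fun i hi => ⟨fr i hi, ?_⟩⟩
  · rcases lt_or_ge i j' with h1 | h1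
    · exact rl i h1
    · rw [rr i h1, (h i (by omega) hi).2]
  · rcases lt_or_ge i j' with h1 | h1
    · rw [rl i h1, (h i hi (by omega)).2]
    · exact rr i h1

/-- Two points with the same image and record on a long interval can be crossed there. -/
theorem exists_crossing [Finite A] (hF : IsMarker F N r) (hT : c.RunsPeriodic F N T)
    (hK : N + T ≤ K) :
    ∃ W : ℕ, ∀ x ∈ c.X, ∀ x' ∈ c.X, ∀ a : ℤ,
      (∀ i, a ≤ i → i ≤ a + W → Same c F T K x x' i) →
      ∃ z ∈ c.X, (∀ i ≤ a + W, Same c F T K z x i) ∧ ∀ i, a ≤ i → Same c F T K z x' i := by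
  set R := r + K + T with hR
  have := Fintype.ofFinite (Set c.State)
  set M := Fintype.card (Set c.State) with hM
  -- A margin 2R at each end (R for the reach of a record, R for depth) leaves room for M + 1
  -- positions spaced by T, one more than there are possible records.
  refine ⟨4 * R + T * (M + 1), fun x hx x' hx' a h => ?_⟩
  set b := a + (4 * R + T * (M + 1) : ℕ) with hb
  have hb' : b = a + 4 * R + (T * M : ℕ) + T := by rw [hb]; push_cast; ring
  -- At a marker the record is the window itself, so the points can be glued directly.
  by_cases hmark : ∃ j, a + R ≤ j ∧ j + R ≤ b ∧ F (c.f x) j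
  · obtain ⟨j, hj, hj', hFj⟩ := hmark
    have hFj' : F (c.f x') j := by
      rwa [← hF.congr (c.f x) _ j fun l _ _ => (h l (by omega) (by omega)).1]
    have hst : c.st x j = c.st x' j := by
      have := (h j (by omega) (by omega)).2
      rwa [record_of_marker hFj, record_of_marker hFj', Set.singleton_eq_singleton_iff] at this
    obtain ⟨z, hz, hl, hr⟩ := c.exists_glue hx hx' hst
    exact ⟨z, hz, same_of_glue hF hx hx' hz (a := a) (j := j) (j' := j) hj le_rfl hj' h hl hr
      (fun i _ _ => by omega) fun _ i _ _ => by omega⟩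
  · push Not at hmark
    obtain ⟨u, hu, hux⟩ := hT (c.f x) (a + R) (b - R) (by omega)
      fun j hj hj' => hmark j hj (by omega)
    have hdeep : ∀ i, a + 2 * R ≤ i → i + 2 * R ≤ b → Deep F K (c.f x) i :=
      fun i hi hi' j hj hj' => hmark j (by omega) (by omega)
    have hdeep' : ∀ i, a + 2 * R ≤ i → i + 2 * R ≤ b → Deep F K (c.f x') i := by
      intro i hi hi'
      rw [← hF.deep_congr (y := c.f x) fun l _ _ => (h l (by omega) (by omega)).1]
      exact hdeep i hi hi'
    have hrec : ∀ i, a + 2 * R ≤ i → i + 2 * R ≤ b →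
        c.record F T K x i = c.cls T u i (c.st x i) := by
      intro i hi hi'
      rw [record_of_deep (hdeep i hi hi')]
      exact cls_congr (fun l _ _ => (hux l (by omega) (by omega)).symm) _
    have hrec' : ∀ i, a + 2 * R ≤ i → i + 2 * R ≤ b →
        c.record F T K x' i = c.cls T u i (c.st x' i) := by
      intro i hi hi'
      rw [record_of_deep (hdeep' i hi hi')]
      refine cls_congr (fun l _ _ => ?_) _
      rw [hux l (by omega) (by omega), (h l (by omega) (by omega)).1]
    obtain ⟨t, t', htt, he⟩ := Fintype.exists_ne_map_eq_of_card_lt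
      (fun t : Fin (M + 1) => c.record F T K x (a + 2 * R + (T * t : ℕ))) (by simp [← hM])
    wlog hlt : t < t' generalizing t t'
    · exact this t' t htt.symm he.symm (lt_of_le_of_ne (not_lt.1 hlt) htt.symm)
    obtain ⟨n, hn⟩ := Nat.exists_eq_add_of_lt (show (t : ℕ) < t' from hlt)
    have hbt : T * (t' : ℕ) ≤ T * M := Nat.mul_le_mul_left _ (by omega)
    have htt' : T * (t' : ℕ) = T * t + T * (n + 1) := by rw [hn]; ring
    set j := a + 2 * R + (T * t : ℕ) with hj
    have hj' : a + 2 * R + (T * t' : ℕ) = j + (T * (n + 1) : ℕ) := by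
      rw [hj, htt']; push_cast; ring
    have hjb : j + (T * (n + 1) : ℕ) + 2 * R ≤ b := by omega
    simp only [hj'] at he
    have e1 : c.cls T u j (c.st x j) = c.cls T u j (c.st x (j + (T * (n + 1) : ℕ))) := by
      rw [← hrec j (by omega) (by omega), he, hrec _ (by omega) hjb, hu.cls_add]
    have e2 : c.cls T u j (c.st x j) = c.cls T u j (c.st x' (j + (T * (n + 1) : ℕ))) := by
      rw [← hrec j (by omega) (by omega), he, (h _ (by omega) (by omega)).2,
        hrec' _ (by omega) hjb, hu.cls_add]
    obtain ⟨w, hw, hwj, hwj', hwu, hwc⟩ := hu.exists_path hx (x' := x')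
      (fun i hi hi' => (hux i (by omega) (by omega)).symm) e1 e2
    -- Follow x up to j, then the connecting point w, then x' after the second position.
    obtain ⟨z₁, hz₁, hl₁, hr₁⟩ := c.exists_glue hx hw hwj.symm
    obtain ⟨z, hz, hl, hr⟩ := c.exists_glue hz₁ hx' ((hr₁ _ (by omega)).trans hwj')
    have hzw : ∀ i, j ≤ i → i < j + (T * (n + 1) : ℕ) → c.st z i = c.st w i :=
      fun i hi hi' => (hl i hi'.le).trans (hr₁ i hi)
    refine ⟨z, hz, same_of_glue hF hx hx' hz (a := a) (b := b) (j := j)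
      (j' := j + (T * (n + 1) : ℕ)) (by omega) (by omega) (by omega) h
      (fun i hi => (hl i (by omega)).trans (hl₁ i hi)) hr (fun i hi hi' => ?_)
      fun hfz i hi hi' => ?_⟩
    · rw [c.f_congr z hz w hw i (hzw i hi hi'), hwu i hi hi', hux i (by omega) (by omega)]
    · have hd : Deep F K (c.f z) i := by
        rw [hF.deep_congr (y' := c.f x) fun l _ _ => hfz l (by omega)]
        exact hdeep i (by omega) (by omega)
      rw [hrec i (by omega) (by omega), record_of_deep hd, hzw i hi.le hi', ← hwc i hi.le hi']
      exact cls_congr (fun l _ _ => by rw [hfz l (by omega), hux l (by omega) (by omega)]) _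

/-- If the records at two deep positions that differ by a multiple of `T` coincide, then the record
`T` positions before the second one is the same. -/
theorem record_eq_of_record_eq (hT : c.RunsPeriodic F N T) (hK : N + T ≤ K)
    {x : ℤ → A} (hx : x ∈ c.X) {i : ℤ} {n : ℕ}
    (hd : Deep F K (c.f x) i) (hd' : Deep F K (c.f x) (i + (T * (n + 1) : ℕ)))
    (hn : T * (n + 1) ≤ K)
    (h : c.record F T K x i = c.record F T K x (i + (T * (n + 1) : ℕ))) :
    Deep F K (c.f x) (i + (T * n : ℕ)) ∧
      c.record F T K x (i + (T * n : ℕ)) = c.record F T K x (i + (T * (n + 1) : ℕ)) := by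
  have hmul : T * (n + 1) = T * n + T := by ring
  -- The two positions are at most K apart, so their marker-free neighbourhoods overlap and form a
  -- single run.
  have hun : ∀ j, i - K ≤ j → j ≤ i + (T * (n + 1) : ℕ) + K → ¬ F (c.f x) j := by
    intro j hj hj'
    rcases le_or_gt j (i + K) with h1 | h1
    · exact hd j hj h1
    · exact hd' j (by omega) hj'
  obtain ⟨u, hu, hux⟩ := hT (c.f x) _ _ (by omega) hun
  have hdm : Deep F K (c.f x) (i + (T * n : ℕ)) := fun j hj hj' => hun j (by omega) (by omega)
  have hc : ∀ m, m ≤ n + 1 → Deep F K (c.f x) (i + (T * m : ℕ)) →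
      c.record F T K x (i + (T * m : ℕ)) = c.cls T u i (c.st x (i + (T * m : ℕ))) := by
    intro m hm hdm
    have : T * m ≤ T * (n + 1) := Nat.mul_le_mul_left _ hm
    rw [record_of_deep hdm, ← hu.cls_add m]
    exact cls_congr (fun l _ _ => (hux l (by omega) (by omega)).symm) _
  refine ⟨hdm, ?_⟩
  have h0 := hc 0 (by omega) (by simpa using hd)
  rw [hc _ le_rfl hd'] at h ⊢
  rw [hc _ (by omega) hdm]
  refine hu.cls_eq_of_cls_eq hx (fun j hj hj' => (hux j (by omega) (by omega)).symm) ?_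
  rw [← h]
  simpa using h0.symm

end LocalFactor
end ShiftSpace

namespace ShiftSpace

/-! ### Counting: sparse words and events -/

/-- Sequences of length `m` with at most `d` entries different from `none`. -/
def sparseWords (Q : Type*) (m d : ℕ) : Set (Fin m → Option Q) :=
  {w | {i | w i ≠ none}.ncard ≤ d}

/-- Give `none` the weight 1 and every other letter the weight t ≤ 1. A sparse word weighs at least
t^d, and all words together weigh (1 + |Q|t)^m. -/
theorem ncard_sparseWords_mul_le {Q : Type*} [Finite Q] (m d : ℕ) {t : ℝ} (ht : 0 < t)
    (ht1 : t ≤ 1) :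
    ((sparseWords Q m d).ncard : ℝ) * t ^ d ≤ (1 + Nat.card Q * t) ^ m := by
  classical
  have := Fintype.ofFinite Q
  let g : Option Q → ℝ := fun o => if o = none then 1 else t
  have hsum : ∑ w : Fin m → Option Q, ∏ i, g (w i) = (1 + Nat.card Q * t) ^ m := by
    have h := Finset.prod_univ_sum (fun _ : Fin m => (Finset.univ : Finset (Option Q)))
      (fun _ o => g o)
    rw [Fintype.piFinset_univ] at h
    rw [← h]
    simp [g, Fintype.sum_option]
  have hpos : ∀ o, 0 ≤ g o := fun o => by dsimp only [g]; split_ifs <;> linarith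
  rw [Set.ncard_eq_toFinset_card' (sparseWords Q m d), ← hsum, ← nsmul_eq_mul]
  refine le_trans ?_ (Finset.sum_le_sum_of_subset_of_nonneg
    (Finset.subset_univ (sparseWords Q m d).toFinset)
    fun w _ _ => Finset.prod_nonneg fun i _ => hpos _)
  refine Finset.card_nsmul_le_sum _ _ _ fun w hw => ?_
  rw [Set.mem_toFinset] at hw
  have : ∏ i, g (w i) = t ^ {i | w i ≠ none}.ncard := by
    rw [Set.ncard_eq_toFinset_card', ← Finset.prod_const]
    simp only [g, Finset.prod_ite, Finset.prod_const_one, one_mul]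
    congr 1
    ext; simp
  rw [this]
  exact pow_le_pow_of_le_one ht.le ht1 hw

theorem log_ncard_sparseWords_le {Q : Type*} [Finite Q] (m d : ℕ) {t : ℝ} (ht : 0 < t)
    (ht1 : t ≤ 1) :
    Real.log (sparseWords Q m d).ncard ≤ d * Real.log t⁻¹ + m * (Nat.card Q * t) := by
  rcases Nat.eq_zero_or_pos (sparseWords Q m d).ncard with h0 | h0
  · rw [h0]
    have : 0 ≤ Real.log t⁻¹ := Real.log_nonneg ((one_le_inv₀ ht).2 ht1)
    simp only [Nat.cast_zero, Real.log_zero]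
    positivity
  · have h0' : (0 : ℝ) < (sparseWords Q m d).ncard := by exact_mod_cast h0
    have h := Real.log_le_log (by positivity) (ncard_sparseWords_mul_le (Q := Q) m d ht ht1)
    rw [Real.log_mul h0'.ne' (by positivity), Real.log_pow, Real.log_pow] at h
    have h1 : Real.log (1 + Nat.card Q * t) ≤ Nat.card Q * t := by
      have := Real.log_le_sub_one_of_pos (show 0 < 1 + Nat.card Q * t by positivity)
      linarith
    have h2 : (m : ℝ) * Real.log (1 + Nat.card Q * t) ≤ m * (Nat.card Q * t) :=
      mul_le_mul_of_nonneg_left h1 (Nat.cast_nonneg _)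
    rw [Real.log_inv]
    linarith

namespace LocalFactor

variable {A B : Type*} {c : LocalFactor A B} {F : (ℤ → B) → ℤ → Prop} {N r : ℕ} {T K : ℕ}

/-- Position `n` of `x` is marked, or the class there cannot be inferred from the one `T` positions
earlier in the same block of length `K`. -/
def Event (c : LocalFactor A B) (F : (ℤ → B) → ℤ → Prop) (T K : ℕ) (x : ℤ → A) (n : ℕ) : Prop :=
  F (c.f x) n ∨ (Deep F K (c.f x) n ∧ ¬ (T ≤ n % K ∧ Deep F K (c.f x) (n - T : ℤ) ∧
    c.record F T K x (n - T : ℤ) = c.record F T K x n))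

open Classical in
/-- The record at the events, `none` elsewhere. -/
noncomputable def eventRecord (c : LocalFactor A B) (F : (ℤ → B) → ℤ → Prop) (T K : ℕ)
    (x : ℤ → A) (n : ℕ) : Option (Set c.State) :=
  if Event c F T K x n then some (c.record F T K x n) else none

/-- Decoding runs from left to right: off the events a record is empty or copied from T positions
earlier. The condition T ≤ n % K keeps that position nonnegative. -/
theorem record_eq_of_eventRecord_eq (hF : IsMarker F N r) (hT : 1 ≤ T) {x x' : ℤ → A} {m : ℕ}
    (hf : ∀ j : ℤ, -(r + K : ℕ) ≤ j → j < m + (r + K : ℕ) → c.f x j = c.f x' j)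
    (he : ∀ n < m, c.eventRecord F T K x n = c.eventRecord F T K x' n) :
    ∀ n < m, c.record F T K x n = c.record F T K x' n := by
  intro n
  induction n using Nat.strong_induction_on with
  | _ n ih =>
    intro hn
    have h := he n hn
    have hFn := hF.congr (c.f x) (c.f x') n fun j _ _ => hf j (by omega) (by omega)
    have hDn := hF.deep_congr (K := K) (y := c.f x) (y' := c.f x') (i := n)
      fun j _ _ => hf j (by omega) (by omega)
    by_cases h1 : Event c F T K x n <;> by_cases h2 : Event c F T K x' n
    · simpa [eventRecord, h1, h2] using h
    · simp [eventRecord, h1, h2] at h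
    · simp [eventRecord, h1, h2] at h
    · simp only [Event, not_or] at h1 h2
      by_cases hd : Deep F K (c.f x) n
      · obtain ⟨hTn, -, e1⟩ := not_not.1 fun h => h1.2 ⟨hd, h⟩
        obtain ⟨-, -, e2⟩ := not_not.1 fun h => h2.2 ⟨hDn.1 hd, h⟩
        have hle : T ≤ n := hTn.trans (Nat.mod_le _ _)
        have := ih (n - T) (by omega) (by omega)
        rw [Nat.cast_sub hle] at this
        rw [← e1, ← e2, this]
      · rw [record_of_not h1.1 hd, record_of_not h2.1 (fun h => hd (hDn.2 h))]

theorem ncard_markers_le (hF : IsMarker F N r) (hN : 1 ≤ N) (y : ℤ → B) (a K : ℕ) :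
    {l : ℕ | l < K ∧ F y (a + l : ℕ)}.ncard ≤ K / N + 1 := by
  refine le_trans (Set.ncard_le_ncard_of_injOn (t := (Finset.range (K / N + 1) : Set ℕ))
    (fun l => l / N) ?_ ?_) ?_
  · rintro l ⟨hl, -⟩
    simp only [Finset.coe_range, Set.mem_Iio]
    exact Nat.lt_succ_of_le (Nat.div_le_div_right hl.le)
  · rintro l ⟨-, hl⟩ l' ⟨-, hl'⟩ h
    have key : ∀ {l l' : ℕ}, F y (a + l : ℕ) → F y (a + l' : ℕ) → l < l' → l / N < l' / N := by
      intro l l' hl hl' hlt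
      have := hF.sep y _ _ hl hl' (by push_cast; omega)
      push_cast at this
      have h' : l + N ≤ l' := by omega
      calc l / N < l / N + 1 := Nat.lt_succ_self _
        _ = (l + N) / N := by rw [Nat.add_div_right _ hN]
        _ ≤ l' / N := Nat.div_le_div_right h'
    rcases lt_trichotomy l l' with hlt | heq | hlt
    · exact absurd h (key hl hl' hlt).ne
    · exact heq
    · exact absurd h (key hl' hl hlt).ne'
  · rw [Set.ncard_coe_finset, Finset.card_range]

/-- Residue modulo T and record determine a change within its block: of two deep positions agreeing
in both, the later one has the same record as its predecessor at distance T
(`record_eq_of_record_eq`), so it is not a change. Depth K equals the block length, hence all deep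
positions of a block lie in one run. -/
theorem ncard_changes_le [Finite A] (hT : c.RunsPeriodic F N T) (hT1 : 1 ≤ T) (hK : N + T ≤ K)
    {x : ℤ → A} (hx : x ∈ c.X) {a : ℕ} (ha : K ∣ a) :
    {l : ℕ | l < K ∧ Deep F K (c.f x) (a + l : ℕ) ∧ ¬ (T ≤ (a + l) % K ∧
      Deep F K (c.f x) ((a + l : ℕ) - T : ℤ) ∧
      c.record F T K x ((a + l : ℕ) - T : ℤ) = c.record F T K x (a + l : ℕ))}.ncard ≤
      T * Nat.card (Set c.State) := by
  refine le_trans (Set.ncard_le_ncard_of_injOn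
    (t := (Finset.range T : Set ℕ) ×ˢ (Set.univ : Set (Set c.State)))
    (fun l => (l % T, c.record F T K x (a + l : ℕ))) ?_ ?_ ?_) ?_
  · rintro l -
    simp [Nat.mod_lt _ hT1]
  · have key : ∀ {l l' : ℕ}, l' < K → Deep F K (c.f x) (a + l : ℕ) →
        Deep F K (c.f x) (a + l' : ℕ) → l < l' → l % T = l' % T →
        c.record F T K x (a + l : ℕ) = c.record F T K x (a + l' : ℕ) →
        T ≤ (a + l') % K ∧ Deep F K (c.f x) ((a + l' : ℕ) - T : ℤ) ∧
          c.record F T K x ((a + l' : ℕ) - T : ℤ) = c.record F T K x (a + l' : ℕ) := by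
      intro l l' hl'K hl hl' hlt hmod h
      obtain ⟨n, hn⟩ := (Nat.modEq_iff_dvd' hlt.le).1 hmod
      rcases n with _ | n
      · omega
      have e : l' = l + T * (n + 1) := by omega
      have e1 : ((a + l' : ℕ) : ℤ) = (a + l : ℕ) + (T * (n + 1) : ℕ) := by
        rw [e]; push_cast; ring
      have e2 : ((a + l' : ℕ) : ℤ) - T = (a + l : ℕ) + (T * n : ℕ) := by
        rw [e]; push_cast; ring
      rw [e2, e1]
      rw [e1] at hl' h
      have hle : T ≤ T * (n + 1) := Nat.le_mul_of_pos_right _ (by omega)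
      refine ⟨?_, record_eq_of_record_eq hT hK hx hl hl' (by omega) h⟩
      obtain ⟨b, rfl⟩ := ha
      rw [Nat.mul_add_mod, Nat.mod_eq_of_lt hl'K]
      omega
    rintro l ⟨hlK, hl, hne⟩ l' ⟨hlK', hl', hne'⟩ h
    simp only [Prod.mk.injEq] at h
    rcases lt_trichotomy l l' with hlt | heq | hlt
    · exact absurd (key hlK' hl hl' hlt h.1 h.2) hne'
    · exact heq
    · exact absurd (key hlK hl' hl hlt h.1.symm h.2.symm) hne
  · exact (Finset.finite_toSet _).prod Set.finite_univ
  · rw [Set.ncard_prod, Set.ncard_coe_finset, Finset.card_range, Set.ncard_univ]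

theorem ncard_events_le [Finite A] (hF : IsMarker F N r) (hN : 1 ≤ N) (hT : c.RunsPeriodic F N T)
    (hT1 : 1 ≤ T) (hK : N + T ≤ K) {x : ℤ → A} (hx : x ∈ c.X) (M : ℕ) :
    {n : ℕ | n < K * M ∧ Event c F T K x n}.ncard ≤
      M * (K / N + 1 + T * Nat.card (Set c.State)) := by
  induction M with
  | zero => simp
  | succ M ih =>
    have hsub : {n : ℕ | n < K * (M + 1) ∧ Event c F T K x n} ⊆
        {n : ℕ | n < K * M ∧ Event c F T K x n} ∪
          (fun l => K * M + l) '' ({l : ℕ | l < K ∧ F (c.f x) (K * M + l : ℕ)} ∪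
            {l : ℕ | l < K ∧ Deep F K (c.f x) (K * M + l : ℕ) ∧ ¬ (T ≤ (K * M + l) % K ∧
              Deep F K (c.f x) ((K * M + l : ℕ) - T : ℤ) ∧
              c.record F T K x ((K * M + l : ℕ) - T : ℤ) =
                c.record F T K x (K * M + l : ℕ))}) := by
      rintro n ⟨hn, he⟩
      rcases lt_or_ge n (K * M) with h | h
      · exact Or.inl ⟨h, he⟩
      · obtain ⟨l, rfl⟩ := Nat.exists_eq_add_of_le h
        have hl : l < K := by rw [mul_add] at hn; omega
        refine Or.inr ⟨l, ?_, rfl⟩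
        rcases he with he | he
        · exact Or.inl ⟨hl, he⟩
        · exact Or.inr ⟨hl, he⟩
    refine (Set.ncard_le_ncard hsub ?_).trans ?_
    · exact ((Set.finite_lt_nat _).subset fun n h => h.1).union
        (Set.Finite.image _ (((Set.finite_lt_nat K).subset fun n h => h.1).union
          ((Set.finite_lt_nat K).subset fun n h => h.1)))
    · refine (Set.ncard_union_le _ _).trans ?_
      rw [Set.ncard_image_of_injective _ (add_right_injective _), add_mul, one_mul]
      refine add_le_add ih ((Set.ncard_union_le _ _).trans ?_)
      exact add_le_add (ncard_markers_le hF hN _ _ _)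
        (ncard_changes_le hT hT1 hK hx (dvd_mul_right _ _))

/-- The image, extended by r + K on both sides so that markers and depth are visible, and the
records at events determine the word of Z. -/
theorem ncard_words_le [Finite A] [Finite B] [TopologicalSpace B] {D : Type*} [Finite D]
    [TopologicalSpace D]
    (hF : IsMarker F N r) (hN : 1 ≤ N) (hT : c.RunsPeriodic F N T) (hT1 : 1 ≤ T) (hK : N + T ≤ K)
    (Y : Subshift B ℤ) (hY : ∀ x ∈ c.X, c.f x ∈ Y.carrier) (e : B × Set c.State → D)
    (Z : Subshift D ℤ)
    (hZ : ∀ z ∈ Z.carrier, ∃ x ∈ c.X, z = fun i => e (c.f x i, c.record F T K x i)) (M : ℕ) :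
    (words Z (K * M)).ncard ≤ (words Y (K * M + 2 * (r + K))).ncard *
      (sparseWords (Set c.State) (K * M)
        (M * (K / N + 1 + T * Nat.card (Set c.State)))).ncard := by
  rw [← Set.ncard_prod]
  have hex : ∀ w ∈ words Z (K * M), ∃ x : ℤ → A,
      x ∈ c.X ∧ ∀ j : Fin (K * M), w j = e (c.f x (j : ℕ), c.record F T K x (j : ℕ)) := by
    rintro w ⟨z, hz, i, hi⟩
    obtain ⟨x, hx, rfl⟩ := hZ z hz
    refine ⟨fun j => x (j + i), c.shift_mem x hx i, fun j => ?_⟩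
    rw [c.f_shift x hx, record_shift hF hx, ← hi j, add_comm]
  rcases (words Z (K * M)).eq_empty_or_nonempty with h0 | ⟨w₀, hw₀⟩
  · simp [h0]
  have : Nonempty (ℤ → A) := ⟨(hex w₀ hw₀).choose⟩
  choose! x hx using hex
  refine Set.ncard_le_ncard_of_injOn (fun w =>
    (fun j : Fin (K * M + 2 * (r + K)) => c.f (x w) (-(r + K : ℕ) + (j : ℕ)),
      fun j : Fin (K * M) => c.eventRecord F T K (x w) j)) ?_ ?_ (Set.toFinite _)
  · intro w hw
    refine ⟨⟨_, hY _ (hx w hw).1, -(r + K : ℕ), fun j => rfl⟩, ?_⟩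
    refine le_trans ?_ (ncard_events_le hF hN hT hT1 hK (hx w hw).1 M)
    refine Set.ncard_le_ncard_of_injOn (fun i => (i : ℕ)) ?_ ?_
      ((Set.finite_lt_nat _).subset fun n h => h.1)
    · intro i hi
      refine ⟨i.2, ?_⟩
      by_contra hne
      simp [eventRecord, hne] at hi
    · exact fun i _ j _ h => Fin.ext h
  · intro w hw w' hw' h
    simp only [Prod.mk.injEq] at h
    have hf : ∀ j : ℤ, -(r + K : ℕ) ≤ j → j < (K * M : ℕ) + (r + K : ℕ) →
        c.f (x w) j = c.f (x w') j := by
      intro j hj hj'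
      have := congrFun h.1 ⟨(j + (r + K : ℕ)).toNat, by omega⟩
      simp only at this
      rwa [show (-(r + K : ℕ) + ((j + (r + K : ℕ)).toNat : ℕ) : ℤ) = j by omega] at this
    have hr := record_eq_of_eventRecord_eq hF hT1 hf fun n hn => congrFun h.2 ⟨n, hn⟩
    funext j
    rw [(hx w hw).2 j, (hx w' hw').2 j, hf j (by omega) (by omega), hr j j.2]

end LocalFactor
end ShiftSpace

namespace ShiftSpace

/-! ### Shift spaces: local rules, finite type, entropy -/

variable {A B D : Type*} [TopologicalSpace A] [TopologicalSpace B] [TopologicalSpace D]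

/-- A continuous map from a shift space to a discrete space depends on finitely many coordinates. -/
theorem exists_local_rule [Finite A] [DiscreteTopology A] [DiscreteTopology D] (X : Subshift A ℤ)
    {g : X.carrier → D} (hg : Continuous g) :
    ∃ k : ℕ, ∀ x x' : X.carrier, (∀ j : ℤ, -k ≤ j → j ≤ k → x.1 j = x'.1 j) → g x = g x' := by
  have : CompactSpace X.carrier := isCompact_iff_compactSpace.1 X.isClosed.isCompact
  by_contra! h
  -- Pairs that violate radius k form a decreasing sequence of compact sets; a pair common to all
  -- would be diagonal, yet have different values under g.
  let t : ℕ → Set (X.carrier × X.carrier) := fun k =>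
    {p | ∀ j : ℤ, -k ≤ j → j ≤ k → p.1.1 j = p.2.1 j} ∩ {p | g p.1 = g p.2}ᶜ
  have hcl : ∀ k, IsClosed (t k) := by
    intro k
    refine IsClosed.inter ?_ ?_
    · simp only [Set.ofPred_forall]
      refine isClosed_iInter fun j => isClosed_iInter fun _ => isClosed_iInter fun _ => ?_
      exact isClosed_eq
        ((continuous_apply j).comp (continuous_subtype_val.comp continuous_fst))
        ((continuous_apply j).comp (continuous_subtype_val.comp continuous_snd))
    · rw [isClosed_compl_iff]
      have : {p : X.carrier × X.carrier | g p.1 = g p.2} =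
          (fun p : X.carrier × X.carrier => (g p.1, g p.2)) ⁻¹' {q | q.1 = q.2} := rfl
      rw [this]
      exact (isOpen_discrete _).preimage (by fun_prop)
  obtain ⟨p, hp⟩ := IsCompact.nonempty_iInter_of_sequence_nonempty_isCompact_isClosed t
    (fun k p hp => ⟨fun j hj hj' => hp.1 j (by push_cast; omega) (by push_cast; omega), hp.2⟩)
    (fun k => by
      obtain ⟨x, x', h1, h2⟩ := h k
      exact ⟨(x, x'), h1, h2⟩) (hcl 0).isCompact hcl
  rw [Set.mem_iInter] at hp
  refine (hp 0).2 ?_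
  have : p.1 = p.2 := Subtype.ext (funext fun j => (hp j.natAbs).1 j (by omega) (by omega))
  simp [this]

/-- A map on a shift space that depends on finitely many coordinates is continuous. -/
theorem continuous_of_local_rule [DiscreteTopology A] (X : Subshift A ℤ)
    {g : X.carrier → D} {a b : ℤ}
    (h : ∀ x x' : X.carrier, (∀ j : ℤ, a ≤ j → j ≤ b → x.1 j = x'.1 j) → g x = g x') :
    Continuous g := by
  refine IsLocallyConstant.continuous ((IsLocallyConstant.iff_eventually_eq g).2 fun x => ?_)
  have : ∀ j ∈ Set.Icc a b, ∀ᶠ y in 𝓝 x, y.1 j = x.1 j := by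
    intro j _
    have hc : Continuous fun y : X.carrier => y.1 j :=
      (continuous_apply j).comp continuous_subtype_val
    exact hc.continuousAt.eventually_mem (IsOpen.mem_nhds (isOpen_discrete {x.1 j}) rfl)
  filter_upwards [(eventually_all_finite (Set.finite_Icc a b)).2 this] with y hy
  exact h y x fun j hj hj' => hy j ⟨hj, hj'⟩

theorem IsCode.map_shift_int {X : Subshift A ℤ} {Y : Subshift B ℤ} {φ : X.carrier → Y.carrier}
    (hφ : IsCode φ) (d : ℤ) (x : X.carrier) :
    (φ ⟨shift d x.1, X.mapsTo d x.2⟩).1 = shift d (φ x).1 := by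
  have one : ∀ x : X.carrier, (φ ⟨shift 1 x.1, X.mapsTo 1 x.2⟩).1 = shift 1 (φ x).1 :=
    fun x => congrArg Subtype.val (hφ.map_shift x)
  induction d using Int.induction_on with
  | zero => simp [shift_zero]
  | succ n ih =>
    have := one ⟨shift (n : ℤ) x.1, X.mapsTo n x.2⟩
    rw [ih] at this
    simp only [← shift_add] at this
    exact this
  | pred n ih =>
    have := one ⟨shift (-n - 1 : ℤ) x.1, X.mapsTo _ x.2⟩
    simp only [← shift_add, sub_add_cancel] at this
    rw [ih] at this
    funext j
    have := congrFun this (j - 1)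
    simp only [shift_apply] at this ⊢
    rw [add_sub_cancel] at this
    rw [← this]
    exact congrArg (φ x).1 (by ring)

/-- Points of a shift of finite type that agree on a long window can be glued there. -/
theorem IsFiniteType.exists_glue {X : Subshift A ℤ} (hX : IsFiniteType X) :
    ∃ k : ℕ, ∀ x ∈ X.carrier, ∀ x' ∈ X.carrier, ∀ a : ℤ,
      (∀ j, a - k ≤ j → j ≤ a + k → x j = x' j) →
        (fun j => if j < a then x j else x' j) ∈ X.carrier := by
  obtain ⟨k, W, hW⟩ := hX
  refine ⟨k, fun x hx x' hx' a h => ?_⟩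
  rw [hW] at hx hx' ⊢
  intro w hw i ho
  rcases lt_or_ge i a with hi | hi
  · refine hx w hw i fun j => ?_
    rw [← ho j]
    dsimp only
    split_ifs with hj
    · rfl
    · exact h _ (by omega) (by omega)
  · refine hx' w hw i fun j => ?_
    rw [← ho j]
    dsimp only
    rw [if_neg (by omega)]

/-- If points agreeing on a long interval can always be crossed there, then the shift space is of
finite type. -/
theorem isFiniteType_of_crossing [DiscreteTopology D] (Z : Subshift D ℤ) (W : ℕ)
    (h : ∀ z ∈ Z.carrier, ∀ z' ∈ Z.carrier, ∀ a : ℤ, (∀ i, a ≤ i → i ≤ a + W → z i = z' i) →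
      ∃ v ∈ Z.carrier, (∀ i ≤ a + W, v i = z i) ∧ ∀ i, a ≤ i → v i = z' i) :
    IsFiniteType Z := by
  -- Consecutive words of length W + 2 overlap in W + 1 letters, exactly the interval needed for a
  -- crossing.
  refine ⟨W + 1, (words Z (W + 2))ᶜ, Set.Subset.antisymm ?_ ?_⟩
  · exact fun z hz w hw i ho => hw ⟨z, hz, i, ho⟩
  intro z hz
  have hloc : ∀ i : ℤ, ∃ v ∈ Z.carrier, ∀ j, i ≤ j → j ≤ i + W + 1 → v j = z j := by
    intro i
    have : (fun j : Fin (W + 2) => z (i + (j : ℕ))) ∈ words Z (W + 2) := by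
      by_contra hne
      exact hz _ hne i fun j => rfl
    obtain ⟨v, hv, l, hl⟩ := this
    refine ⟨_, Z.mapsTo (l - i) hv, fun j hj hj' => ?_⟩
    have := hl ⟨(j - i).toNat, by omega⟩
    simp only [Int.toNat_of_nonneg (sub_nonneg.2 hj), add_sub_cancel] at this
    rw [← this, shift_apply]
    congr 1
    ring
  -- Crossing local approximants successively gives points of Z that agree with z on ever longer
  -- intervals; closedness of Z then finishes the proof.
  have hlong : ∀ (s : ℤ) (n : ℕ), ∃ v ∈ Z.carrier, ∀ j, s ≤ j → j ≤ s + n + W + 1 → v j = z j := by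
    intro s n
    induction n with
    | zero => simpa using hloc s
    | succ n ih =>
      obtain ⟨v, hv, hvz⟩ := ih
      obtain ⟨v', hv', hvz'⟩ := hloc (s + n + 1)
      obtain ⟨w, hw, hwl, hwr⟩ := h v hv v' hv' (s + n + 1) fun i hi hi' => by
        rw [hvz i (by omega) (by omega), hvz' i (by omega) (by omega)]
      refine ⟨w, hw, fun j hj hj' => ?_⟩
      rcases le_or_gt j (s + n + 1) with hlt | hlt
      · rw [hwl j (by omega), hvz j hj (by omega)]
      · rw [hwr j (by omega), hvz' j (by omega) (by push_cast at hj'; omega)]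
  choose v hv hvz using fun n : ℕ => hlong (-n) (2 * n)
  refine Z.isClosed.mem_of_tendsto (f := v) (b := atTop) ?_ (Eventually.of_forall hv)
  refine tendsto_pi_nhds.2 fun j => ?_
  refine tendsto_const_nhds.congr' ?_
  filter_upwards [eventually_ge_atTop j.natAbs] with n hn
  exact (hvz n j (by omega) (by push_cast; omega)).symm

theorem ncard_words_pos [Finite A] {X : Subshift A ℤ} (hX : X.carrier.Nonempty) (n : ℕ) :
    0 < (words X n).ncard := by
  obtain ⟨x, hx⟩ := hX
  exact (Set.ncard_pos (Set.toFinite _)).2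
    ⟨fun j => x (0 + ((j : ℕ) : ℤ)), x, hx, 0, fun _ => rfl⟩

theorem entropy_eq_zero_of_isEmpty {X : Subshift A ℤ} (hX : X.carrier = ∅) : entropy X = 0 := by
  have : (fun n : ℕ => (1 / (n : ℝ)) * Real.log ((words X n).ncard : ℝ)) = fun _ => 0 := by
    funext n
    simp [words, hX]
  rw [entropy, this]
  exact tendsto_const_nhds.limUnder_eq

theorem entropy_le_of_ncard_words_le [Finite A] [Finite B] {X : Subshift A ℤ} {Y : Subshift B ℤ}
    (h : ∀ n, (words Y n).ncard ≤ (words X n).ncard) : entropy Y ≤ entropy X := by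
  refine le_of_tendsto_of_tendsto' (tendsto_entropy Y) (tendsto_entropy X) fun n => ?_
  refine mul_le_mul_of_nonneg_left ?_ (by positivity)
  rcases Nat.eq_zero_or_pos (words Y n).ncard with h0 | h0
  · rw [h0]
    simpa using Real.log_natCast_nonneg _
  · exact Real.log_le_log (by exact_mod_cast h0) (by exact_mod_cast h n)

/-- Both limits are taken along the lengths KM. The s extra letters contribute a bounded term that
vanishes after division, and Md ≤ δKM bounds the sparse factor. -/
theorem entropy_le_add [Finite B] [Finite D] {Y : Subshift B ℤ} {Z : Subshift D ℤ}
    (hY : Y.carrier.Nonempty) (hZ : Z.carrier.Nonempty) {Q : Type*} [Finite Q] {K s d : ℕ}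
    (hK : 1 ≤ K) {δ t : ℝ} (ht : 0 < t) (ht1 : t ≤ 1) (hd : (d : ℝ) ≤ δ * K)
    (h : ∀ M, (words Z (K * M)).ncard ≤
      (words Y (K * M + s)).ncard * (sparseWords Q (K * M) (M * d)).ncard) :
    entropy Z ≤ entropy Y + (δ * Real.log t⁻¹ + Nat.card Q * t) := by
  have hKM : Tendsto (fun M : ℕ => K * M) atTop atTop :=
    tendsto_id.const_mul_atTop' hK
  have l1 := (tendsto_entropy Z).comp hKM
  have l2 := (tendsto_entropy Y).comp hKM
  have l3 : Tendsto (fun n : ℕ => (1 / (n : ℝ)) * Real.log (words Y s).ncard) atTop (𝓝 0) := by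
    simpa using tendsto_one_div_atTop_nhds_zero_nat.mul_const (Real.log (words Y s).ncard)
  have l4 := (l2.add (l3.comp hKM)).add_const (δ * Real.log t⁻¹ + Nat.card Q * t)
  rw [add_zero] at l4
  refine le_of_tendsto_of_tendsto l1 l4 ?_
  filter_upwards [eventually_ge_atTop 1] with M hM
  simp only [Function.comp_apply]
  set m := K * M with hm
  have hm0 : (0 : ℝ) < m := by exact_mod_cast Nat.mul_pos hK hM
  have p1 : (0 : ℝ) < (words Z m).ncard := by exact_mod_cast ncard_words_pos hZ m
  have p2 : (0 : ℝ) < (words Y m).ncard := by exact_mod_cast ncard_words_pos hY m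
  have p3 : (0 : ℝ) < (words Y s).ncard := by exact_mod_cast ncard_words_pos hY s
  have h1 : ((words Z m).ncard : ℝ) ≤ (words Y m).ncard * (words Y s).ncard *
      (sparseWords Q m (M * d)).ncard := by
    exact_mod_cast (h M).trans (Nat.mul_le_mul_right _ (ncard_words_add_le Y m s))
  have p4 : (0 : ℝ) < (sparseWords Q m (M * d)).ncard := by
    by_contra hne
    have : ((sparseWords Q m (M * d)).ncard : ℝ) = 0 :=
      le_antisymm (not_lt.1 hne) (Nat.cast_nonneg _)
    rw [this, mul_zero] at h1
    linarith
  have h2 := Real.log_le_log p1 h1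
  rw [Real.log_mul (by positivity) p4.ne', Real.log_mul p2.ne' p3.ne'] at h2
  have h3 := log_ncard_sparseWords_le (Q := Q) m (M * d) ht ht1
  have hL : 0 ≤ Real.log t⁻¹ := Real.log_nonneg ((one_le_inv₀ ht).2 ht1)
  have h4 : ((M * d : ℕ) : ℝ) * Real.log t⁻¹ ≤ m * (δ * Real.log t⁻¹) := by
    rw [← mul_assoc]
    refine mul_le_mul_of_nonneg_right ?_ hL
    rw [hm]
    push_cast
    nlinarith [mul_le_mul_of_nonneg_left hd (Nat.cast_nonneg (α := ℝ) M)]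
  rw [← mul_add, one_div, inv_mul_le_iff₀ hm0, mul_add, mul_inv_cancel_left₀ hm0.ne']
  linarith

end ShiftSpace

namespace ShiftSpace

/-! ### Assembling the intermediate shift -/

theorem exists_localFactor {A B : Type*} [TopologicalSpace A] [TopologicalSpace B] [Finite A]
    [DiscreteTopology A] [DiscreteTopology B] {X : Subshift A ℤ} {Y : Subshift B ℤ}
    (hX : IsFiniteType X) {φ : X.carrier → Y.carrier} (hφ : IsCode φ) (y₀ : ℤ → B) :
    ∃ c : LocalFactor A B, c.X = X.carrier ∧ ∀ x : X.carrier, c.f x.1 = (φ x).1 := by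
  classical
  obtain ⟨k₁, h₁⟩ := exists_local_rule X (g := fun x => (φ x).1 0)
    ((continuous_apply 0).comp (continuous_subtype_val.comp hφ.continuous))
  obtain ⟨k₂, h₂⟩ := hX.exists_glue
  have hshift : ∀ (x : ℤ → A) (d : ℤ), (fun j => x (j + d)) = shift d x :=
    fun x d => funext fun j => by rw [shift_apply, add_comm]
  -- The value off X is arbitrary: the axioms concern points of X only.
  let f : (ℤ → A) → ℤ → B := fun x => if h : x ∈ X.carrier then (φ ⟨x, h⟩).1 else y₀
  have hf : ∀ x (h : x ∈ X.carrier), f x = (φ ⟨x, h⟩).1 := fun x h => dif_pos h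
  have hfs : ∀ x ∈ X.carrier, ∀ d i : ℤ, f (fun j => x (j + d)) i = f x (i + d) := by
    intro x hx d i
    have := congrFun (hφ.map_shift_int d ⟨x, hx⟩) i
    rw [hshift, hf _ (X.mapsTo d hx), this, hf x hx, shift_apply, add_comm]
  refine ⟨⟨X.carrier, f, max k₁ k₂, fun x hx d => ?_, hfs, fun x hx x' hx' i hs => ?_,
    fun x hx x' hx' a hs => ?_⟩, rfl, fun x => hf x.1 x.2⟩
  · rw [hshift]
    exact X.mapsTo d hx
  · have hs := state_eq_iff.1 hs
    have e := hfs x hx i 0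
    have e' := hfs x' hx' i 0
    rw [zero_add] at e e'
    rw [← e, ← e', hshift, hshift, hf _ (X.mapsTo i hx), hf _ (X.mapsTo i hx')]
    refine h₁ ⟨_, X.mapsTo i hx⟩ ⟨_, X.mapsTo i hx'⟩ fun j hj hj' => ?_
    have := le_max_left k₁ k₂
    simp only [shift_apply]
    exact hs _ (by omega) (by omega)
  · have hs := state_eq_iff.1 hs
    have := le_max_right k₁ k₂
    exact h₂ x hx x' hx' a fun j hj hj' => hs j (by omega) (by omega)

/-- Constants that make the entropy of the records small. -/
theorem exists_record_constants {ε : ℝ} (hε : 0 < ε) (Q : ℕ) :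
    ∃ (t δ : ℝ) (N : ℕ), 0 < t ∧ t ≤ 1 ∧ 1 ≤ N ∧ δ * Real.log t⁻¹ + Q * t < ε ∧
      ∀ T : ℕ, ∃ K : ℕ, 1 ≤ K ∧ N + T ≤ K ∧ ((K / N + 1 + T * Q : ℕ) : ℝ) ≤ δ * K := by
  set t : ℝ := min 1 (ε / (4 * (Q + 1))) with ht
  have ht0 : 0 < t := lt_min one_pos (by positivity)
  have ht1 : t ≤ 1 := min_le_left _ _
  have hQt : Q * t ≤ ε / 4 := by
    have h1 : t ≤ ε / (4 * (Q + 1)) := min_le_right _ _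
    rw [le_div_iff₀ (by positivity)] at h1
    nlinarith
  have hL : 0 ≤ Real.log t⁻¹ := Real.log_nonneg ((one_le_inv₀ ht0).2 ht1)
  set δ : ℝ := ε / (4 * (Real.log t⁻¹ + 1)) with hδ
  have hδ0 : 0 < δ := by positivity
  have hδL : δ * Real.log t⁻¹ ≤ ε / 4 := by
    have h1 : δ * (4 * (Real.log t⁻¹ + 1)) = ε := div_mul_cancel₀ _ (by positivity)
    nlinarith
  -- N > 2/δ makes K/N at most half of δK; the other half absorbs 1 + TQ. K is chosen after T,
  -- because T will depend on N.
  obtain ⟨N, hN⟩ := exists_nat_gt (2 / δ)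
  have hN0 : (0 : ℝ) < N := lt_trans (by positivity) hN
  refine ⟨t, δ, N, ht0, ht1, by exact_mod_cast hN0, by linarith, fun T => ?_⟩
  obtain ⟨K, hK⟩ := exists_nat_gt (2 * (1 + T * Q) / δ)
  refine ⟨K + N + T + 1, by omega, by omega, ?_⟩
  set K' := K + N + T + 1 with hK'
  have hKK : (K : ℝ) ≤ K' := by exact_mod_cast (by omega : K ≤ K')
  have h1 : ((K' / N : ℕ) : ℝ) ≤ K' / N := Nat.cast_div_le
  have h2 : (K' : ℝ) / N ≤ δ / 2 * K' := by
    rw [div_le_iff₀ hN0]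
    rw [div_lt_iff₀ hδ0] at hN
    nlinarith [Nat.cast_nonneg (α := ℝ) K']
  rw [div_lt_iff₀ hδ0] at hK
  push_cast
  nlinarith

end ShiftSpace

open ShiftSpace

theorem mainTheorem3 {A B : Type*}
    [Finite A] [TopologicalSpace A] [DiscreteTopology A]
    [Finite B] [TopologicalSpace B] [DiscreteTopology B]
    (X : Subshift A ℤ) (Y : Subshift B ℤ) (hX : ShiftSpace.IsFiniteType X)
    (φ : X.carrier → Y.carrier) (hφ : ShiftSpace.IsFactorCode φ)
    (hXY : ShiftSpace.entropy Y < ShiftSpace.entropy X)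
    (ε : ℝ) (hε : 0 < ε) :
    ∃ (k : ℕ) (Z : Subshift (Fin k) ℤ) (φ₁ : X.carrier → Z.carrier) (φ₂ : Z.carrier → Y.carrier),
      ShiftSpace.IsFactorCode φ₁ ∧ ShiftSpace.IsFactorCode φ₂ ∧ φ = φ₂ ∘ φ₁ ∧
        |ShiftSpace.entropy Z - ShiftSpace.entropy Y| < ε ∧ ShiftSpace.IsFiniteType Z := by
  -- If X were empty, so would be Y, and both entropies would be 0, against the strict inequality.
  have hXne : X.carrier.Nonempty := by
    by_contra hne
    have hXe := Set.not_nonempty_iff_eq_empty.1 hne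
    have hYe : Y.carrier = ∅ := by
      refine Set.eq_empty_of_forall_notMem fun y hy => ?_
      obtain ⟨x, -⟩ := hφ.surjective ⟨y, hy⟩
      exact hne ⟨x.1, x.2⟩
    rw [entropy_eq_zero_of_isEmpty hXe, entropy_eq_zero_of_isEmpty hYe] at hXY
    exact lt_irrefl _ hXY
  obtain ⟨x₀, hx₀⟩ := hXne
  obtain ⟨c, hcX, hcf⟩ := exists_localFactor hX hφ.isCode (φ ⟨x₀, hx₀⟩).1
  have hmem : ∀ x : X.carrier, x.1 ∈ c.X := fun x => by rw [hcX]; exact x.2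
  have hcY : ∀ x ∈ c.X, c.f x ∈ Y.carrier := by
    intro x hx
    rw [hcX] at hx
    rw [hcf ⟨x, hx⟩]
    exact (φ _).2
  obtain ⟨t, δ, N, ht, ht1, hN, hsmall, hKex⟩ :=
    exists_record_constants hε (Nat.card (Set c.State))
  obtain ⟨r, F, hF, hcov⟩ := exists_marker B hN
  obtain ⟨q, hq1, hq⟩ := exists_idempotent_exponent (Set c.State)
  have hT : c.RunsPeriodic F N (N.factorial * q) := LocalFactor.runsPeriodic hcov hq
  have hT1 : 1 ≤ N.factorial * q := Nat.mul_pos N.factorial_pos hq1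
  set T := N.factorial * q
  obtain ⟨K, hK1, hK, hKδ⟩ := hKex T
  obtain ⟨W, hW⟩ := LocalFactor.exists_crossing hF hT hK
  let e := Finite.equivFin (B × Set c.State)
  let ψ : (ℤ → A) → ℤ → Fin (Nat.card (B × Set c.State)) :=
    fun x i => e (c.f x i, c.record F T K x i)
  have hψshift : ∀ x ∈ X.carrier, ∀ d : ℤ, ψ (shift d x) = shift d (ψ x) := by
    intro x hx d
    have hs : shift d x = fun j => x (j + d) := funext fun j => by rw [shift_apply, add_comm]
    rw [← hcX] at hx
    funext i
    rw [hs]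
    simp only [ψ, shift_apply]
    rw [c.f_shift x hx, LocalFactor.record_shift hF hx, add_comm]
  have hψcont : Continuous fun x : X.carrier => ψ x.1 := by
    refine continuous_pi fun i => ?_
    refine continuous_of_local_rule X (a := i - (r + K + T + c.k : ℕ))
      (b := i + (r + K + T + c.k : ℕ)) fun x x' h => ?_
    have hst : ∀ j, i - (r + K + T : ℕ) ≤ j → j ≤ i + (r + K + T : ℕ) →
        c.st x.1 j = c.st x'.1 j :=
      fun j hj hj' => state_eq_iff.2 fun l _ _ => h l (by omega) (by omega)
    have hf : ∀ j, i - (r + K + T : ℕ) ≤ j → j ≤ i + (r + K + T : ℕ) →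
        c.f x.1 j = c.f x'.1 j :=
      fun j hj hj' => c.f_congr _ (hmem x) _ (hmem x') j (hst j hj hj')
    simp only [ψ]
    rw [hf i (by omega) (by omega), LocalFactor.record_congr hF hf (hst i (by omega) (by omega))]
  have : CompactSpace X.carrier := isCompact_iff_compactSpace.1 X.isClosed.isCompact
  let Z : Subshift (Fin (Nat.card (B × Set c.State))) ℤ :=
    { carrier := Set.range fun x : X.carrier => ψ x.1
      isClosed := (isCompact_range hψcont).isClosed
      mapsTo := by
        rintro d _ ⟨x, rfl⟩
        exact ⟨⟨_, X.mapsTo d x.2⟩, hψshift x.1 x.2 d⟩ }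
  let π : (ℤ → Fin (Nat.card (B × Set c.State))) → ℤ → B := fun z i => (e.symm (z i)).1
  have hπψ : ∀ x : X.carrier, π (ψ x.1) = (φ x).1 := fun x => by
    rw [← hcf x]
    funext i
    simp [π, ψ]
  have hπZ : ∀ z ∈ Z.carrier, π z ∈ Y.carrier := by
    rintro _ ⟨x, rfl⟩
    simp only [hπψ]
    exact (φ x).2
  have hZne : Z.carrier.Nonempty := ⟨_, ⟨x₀, hx₀⟩, rfl⟩
  -- Forgetting the records maps the words of Z onto those of Y.
  have hle : entropy Y ≤ entropy Z := by
    refine entropy_le_of_ncard_words_le fun n => ?_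
    refine (Set.ncard_le_ncard ?_ (Set.toFinite _)).trans
      (Set.ncard_image_le (f := fun w i => (e.symm (w i)).1) (Set.toFinite (words Z n)))
    rintro w ⟨y, hy, i, hw⟩
    obtain ⟨x, hx⟩ := hφ.surjective ⟨y, hy⟩
    refine ⟨fun j => ψ x.1 (i + (j : ℕ)), ⟨_, ⟨x, rfl⟩, i, fun j => rfl⟩, funext fun j => ?_⟩
    have := congrFun (hπψ x) (i + (j : ℕ))
    rw [hx] at this
    exact this.trans (hw j)
  have hge : entropy Z ≤ entropy Y +
      (δ * Real.log t⁻¹ + Nat.card (Set c.State) * t) := by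
    refine entropy_le_add (s := 2 * (r + K)) ⟨_, (φ ⟨x₀, hx₀⟩).2⟩ hZne hK1 ht ht1 hKδ fun M => ?_
    refine LocalFactor.ncard_words_le hF hN hT hT1 hK Y hcY e Z ?_ M
    rintro _ ⟨x, rfl⟩
    exact ⟨x.1, hmem x, rfl⟩
  refine ⟨_, Z, fun x => ⟨ψ x.1, x, rfl⟩, fun z => ⟨π z.1, hπZ z.1 z.2⟩, ⟨⟨?_, ?_⟩, ?_⟩,
    ⟨⟨?_, ?_⟩, ?_⟩, ?_, ?_, ?_⟩
  · exact hψcont.subtype_mk _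
  · exact fun x => Subtype.ext (hψshift x.1 x.2 1)
  · rintro ⟨_, x, rfl⟩
    exact ⟨x, rfl⟩
  · refine Continuous.subtype_mk (continuous_pi fun i => ?_) _
    exact (continuous_of_discreteTopology (f := fun a => (e.symm a).1)).comp
      ((continuous_apply i).comp continuous_subtype_val)
  · exact fun z => rfl
  · intro y
    obtain ⟨x, rfl⟩ := hφ.surjective y
    exact ⟨⟨_, x, rfl⟩, Subtype.ext (hπψ x)⟩
  · exact funext fun x => Subtype.ext (hπψ x).symm
  · rw [abs_lt]
    constructor <;> linarith
  · refine isFiniteType_of_crossing Z W ?_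
    have hsame : ∀ x x' i, ψ x i = ψ x' i ↔ LocalFactor.Same c F T K x x' i := by
      intro x x' i
      simp [ψ, LocalFactor.Same]
    rintro _ ⟨x, rfl⟩ _ ⟨x', rfl⟩ a h
    obtain ⟨z, hz, hl, hr⟩ := hW x.1 (hmem x) x'.1 (hmem x') a
      fun i hi hi' => (hsame _ _ _).1 (h i hi hi')
    rw [hcX] at hz
    exact ⟨_, ⟨⟨z, hz⟩, rfl⟩, fun i hi => (hsame _ _ _).2 (hl i hi),
      fun i hi => (hsame _ _ _).2 (hr i hi)⟩
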